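/- Let $k$ be a perfect field of characteristic $p>0$. For a field extension $K/k$ with perfect closure $K^{\mathrm{perf}}$, let $\mathcal D_\infty(K/k)$ be the category of triples $(V,W,\psi)$, where $V$ is a finite dimensional $K$-vector space, $W$ is a finite dimensional $k$-vector space and $\psi\colon K^{\mathrm{perf}}\otimes_K V\to K^{\mathrm{perf}}\otimes_k W$ is a $K^{\mathrm{perf}}$-linear isomorphism; a morphism is a pair consisting of a $K$-linear and a $k$-linear map compatible with the isomorphisms $\psi$. Let $\pi^{\mathrm L}(K/k)$ be the Tannakian group scheme over $k$ of $\mathcal D_\infty(K/k)$, i.e. the group scheme $\underline{\mathrm{Aut}}^{\otimes}(\omega)$ of tensor automorphisms of the fibre functor $\omega\colon (V,W,\psi)\mapsto W$. For an extension $L/K$, the pullback functor $(V,W,\psi)\mapsto (L\otimes_K V,W,L^{\mathrm{perf}}\otimes_{K^{\mathrm{perf}}}\psi)$ induces a homomorphism $\pi^{\mathrm L}(L/k)\to\pi^{\mathrm L}(K/k)$; for $L/K$ purely inseparable, $\pi^{\mathrm L}(L/k)$ is regarded through it as a subgroup of $\pi^{\mathrm L}(K/k)$. Let $K/k$ be a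 field extension such that $K$ is not perfect. Then: 1. There is a closed subgroup $H$ of $\pi^{\mathrm L}(K/k)$ which is not of the form $\pi^{\mathrm L}(L/k)$ for any purely inseparable extension $L/K$. 2. If $L/K$ is a nontrivial purely inseparable extension, then the quotient $\pi^{\mathrm L}(K/k)/\pi^{\mathrm L}(L/k)$ is not finite over $k$: the fpqc quotient is not the spectrum of a finite $k$-algebra and, moreover, the $k$-algebra of functions on it (the functions on $\pi^{\mathrm L}(K/k)$ invariant under right translation by $\pi^{\mathrm L}(L/k)$) is infinite dimensional over $k$. 3. If $\lambda\in K$ is not a $p$-th power in $K$ and $L=K[X]/(X^p-\lambda)$, then the group $L^*/K^*$ is infinite and not finitely generated. -/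

import Mathlib

open CategoryTheory TensorProduct

universe u

noncomputable section

namespace LocalNori

/-! ## Base change of endomorphisms along a map of `k`-algebras -/

section BaseChange

variable {k : Type u} [CommRing k] {R S T : Type u} [CommRing R] [Algebra k R] [CommRing S]
  [Algebra k S] [CommRing T] [Algebra k T] (W : Type u) [AddCommGroup W] [Module k W]

/-- The map `R ⊗ W → S ⊗ W` induced by a `k`-algebra map `f : R → S`. -/
def extend (f : R →ₐ[k] S) : R ⊗[k] W →ₗ[k] S ⊗[k] W := f.toLinearMap.rTensor W

@[simp] lemma extend_tmul (f : R →ₐ[k] S) (r : R) (w : W) :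
    extend W f (r ⊗ₜ w) = f r ⊗ₜ w := rfl

lemma extend_smul (f : R →ₐ[k] S) (r : R) (x : R ⊗[k] W) :
    extend W f (r • x) = f r • extend W f x := by
  induction x with
  | zero => simp
  | tmul a w => simp [TensorProduct.smul_tmul']
  | add a b ha hb => simp [ha, hb]

variable {W}

/-- The `S`-linear endomorphism of `S ⊗ W` obtained from an `R`-linear endomorphism of `R ⊗ W`
by base change along `f`; it sends `1 ⊗ w` to the image of `e (1 ⊗ w)`. -/
def endMapFun (f : R →ₐ[k] S) (e : Module.End R (R ⊗[k] W)) : Module.End S (S ⊗[k] W) :=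
  LinearMap.liftBaseChange S
    (extend W f ∘ₗ (e.restrictScalars k) ∘ₗ (TensorProduct.mk k R W 1))

lemma endMapFun_one_tmul (f : R →ₐ[k] S) (e : Module.End R (R ⊗[k] W)) (w : W) :
    endMapFun f e (1 ⊗ₜ w) = extend W f (e (1 ⊗ₜ w)) := by
  simp [endMapFun]

lemma endMapFun_extend (f : R →ₐ[k] S) (e : Module.End R (R ⊗[k] W)) (x : R ⊗[k] W) :
    endMapFun f e (extend W f x) = extend W f (e x) := by
  induction x with
  | zero => simp
  | tmul r w =>
    have h1 : (r ⊗ₜ[k] w : R ⊗[k] W) = r • ((1 : R) ⊗ₜ[k] w) := by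
      simp [TensorProduct.smul_tmul']
    rw [h1, extend_smul, map_smul, map_smul, extend_smul]
    simp [endMapFun_one_tmul]
  | add a b ha hb => simp [ha, hb]

lemma end_ext {e e' : Module.End S (S ⊗[k] W)} (h : ∀ w : W, e (1 ⊗ₜ w) = e' (1 ⊗ₜ w)) :
    e = e' := by
  apply TensorProduct.AlgebraTensorModule.curry_injective
  ext w
  simpa using h w

/-- Base change of endomorphisms, as a monoid homomorphism. -/
def endMap (f : R →ₐ[k] S) : Module.End R (R ⊗[k] W) →* Module.End S (S ⊗[k] W) where
  toFun := endMapFun f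
  map_one' := end_ext fun w => by simp [endMapFun_one_tmul]
  map_mul' a b := end_ext fun w => by
    rw [endMapFun_one_tmul, Module.End.mul_apply, Module.End.mul_apply, endMapFun_one_tmul,
      endMapFun_extend]

lemma endMap_extend (f : R →ₐ[k] S) (e : Module.End R (R ⊗[k] W)) (x : R ⊗[k] W) :
    endMap f e (extend W f x) = extend W f (e x) := endMapFun_extend f e x

lemma endMap_one_tmul (f : R →ₐ[k] S) (e : Module.End R (R ⊗[k] W)) (w : W) :
    endMap f e (1 ⊗ₜ w) = extend W f (e (1 ⊗ₜ w)) := endMapFun_one_tmul f e w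

lemma extend_id (x : R ⊗[k] W) : extend W (AlgHom.id k R) x = x := by
  simp [extend]

lemma extend_comp (f : R →ₐ[k] S) (g : S →ₐ[k] T) (x : R ⊗[k] W) :
    extend W (g.comp f) x = extend W g (extend W f x) := by
  simp [extend, LinearMap.rTensor_comp]

lemma endMap_id (e : Module.End R (R ⊗[k] W)) : endMap (AlgHom.id k R) e = e :=
  end_ext fun w => by rw [endMap_one_tmul, extend_id]

lemma endMap_comp (f : R →ₐ[k] S) (g : S →ₐ[k] T) (e : Module.End R (R ⊗[k] W)) :
    endMap (g.comp f) e = endMap g (endMap f e) :=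
  end_ext fun w => by
    rw [endMap_one_tmul, endMap_one_tmul, endMap_one_tmul, extend_comp]

end BaseChange

/-! ## The category of triples -/

/-- A triple `(V, W, ψ)`: a finite dimensional `K`-vector space `V`, a finite dimensional
`k`-vector space `W` and an `Ω`-linear isomorphism `ψ : Ω ⊗_K V ≃ Ω ⊗_k W`.
For `Ω` a perfect closure of `K` these are the objects of the category `𝒟_∞(K/k)`. -/
structure Triple (k K Ω : Type u) [Field k] [Field K] [Field Ω] [Algebra k Ω] [Algebra K Ω] where
  V : Type u
  W : Type u
  [addCommGroupV : AddCommGroup V]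
  [moduleV : Module K V]
  [finiteV : Module.Finite K V]
  [addCommGroupW : AddCommGroup W]
  [moduleW : Module k W]
  [finiteW : Module.Finite k W]
  ψ : Ω ⊗[K] V ≃ₗ[Ω] Ω ⊗[k] W

namespace Triple

attribute [instance] addCommGroupV moduleV finiteV addCommGroupW moduleW finiteW

variable {k K Ω : Type u} [Field k] [Field K] [Field Ω] [Algebra k Ω] [Algebra K Ω]

/-- A morphism of triples: a `K`-linear map `a` and a `k`-linear map `b`
compatible with the isomorphisms `ψ`. -/
@[ext]
structure Hom (X Y : Triple k K Ω) where
  a : X.V →ₗ[K] Y.V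
  b : X.W →ₗ[k] Y.W
  comm : ∀ x : Ω ⊗[K] X.V, Y.ψ (a.baseChange Ω x) = b.baseChange Ω (X.ψ x)

instance : Category (Triple k K Ω) where
  Hom X Y := Hom X Y
  id X := ⟨LinearMap.id, LinearMap.id, fun x => by simp⟩
  comp f g := ⟨g.a ∘ₗ f.a, g.b ∘ₗ f.b, fun x => by
    simp [LinearMap.baseChange_comp, f.comm, g.comm]⟩

/-- The tensor product `(V ⊗_K V', W ⊗_k W', ψ ⊗ ψ')`. -/
abbrev tensor (X Y : Triple k K Ω) : Triple k K Ω where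
  V := X.V ⊗[K] Y.V
  W := X.W ⊗[k] Y.W
  ψ := AlgebraTensorModule.distribBaseChange K Ω X.V Y.V ≪≫ₗ
    TensorProduct.congr X.ψ Y.ψ ≪≫ₗ
    (AlgebraTensorModule.distribBaseChange k Ω X.W Y.W).symm

lemma tensor_ψ (X Y : Triple k K Ω) (v : X.V) (w : Y.V) :
    (X.tensor Y).ψ (1 ⊗ₜ (v ⊗ₜ w)) =
      (AlgebraTensorModule.distribBaseChange k Ω X.W Y.W).symm (X.ψ (1 ⊗ₜ v) ⊗ₜ Y.ψ (1 ⊗ₜ w)) := by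
  simp [AlgebraTensorModule.distribBaseChange_tmul]

variable (k K Ω) in
/-- The unit triple `(K, k, can)`. -/
abbrev unit : Triple k K Ω where
  V := K
  W := k
  ψ := AlgebraTensorModule.rid K Ω Ω ≪≫ₗ (AlgebraTensorModule.rid k Ω Ω).symm

end Triple

/-! ## The Tannakian group -/

section Tannaka

variable (k K Ω : Type u) [Field k] [Field K] [Field Ω] [Algebra k Ω] [Algebra K Ω]

/-- The group `Aut^⊗(ω_R)` of `R`-linear tensor automorphisms of the fibre functor
`ω_R : (V, W, ψ) ↦ R ⊗_k W`. -/
def tensorAut (R : Type u) [CommRing R] [Algebra k R] :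
    Subgroup (∀ X : Triple k K Ω, LinearMap.GeneralLinearGroup R (R ⊗[k] X.W)) where
  carrier := {g |
    (∀ (X Y : Triple k K Ω) (φ : X ⟶ Y) (x : R ⊗[k] X.W),
      (g Y).1 (φ.b.baseChange R x) = φ.b.baseChange R ((g X).1 x)) ∧
    (∀ (X Y : Triple k K Ω) (x : R ⊗[k] (X.W ⊗[k] Y.W)),
      AlgebraTensorModule.distribBaseChange k R X.W Y.W ((g (X.tensor Y)).1 x) =
        TensorProduct.map (g X).1 (g Y).1
          (AlgebraTensorModule.distribBaseChange k R X.W Y.W x)) ∧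
    g (Triple.unit k K Ω) = 1}
  one_mem' := by
    refine ⟨fun X Y φ x => by simp, fun X Y x => ?_, rfl⟩
    change _ = TensorProduct.map LinearMap.id LinearMap.id _
    rw [TensorProduct.map_id]
    rfl
  mul_mem' := by
    rintro g h ⟨g1, g2, g3⟩ ⟨h1, h2, h3⟩
    refine ⟨fun X Y φ x => ?_, fun X Y x => ?_, by simp [g3, h3]⟩
    · simp [h1, g1]
    · change AlgebraTensorModule.distribBaseChange k R X.W Y.W
        ((g (X.tensor Y)).1 ((h (X.tensor Y)).1 x)) =
        TensorProduct.map ((g X).1 ∘ₗ (h X).1) ((g Y).1 ∘ₗ (h Y).1) _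
      rw [g2, h2, TensorProduct.map_comp]
      rfl
  inv_mem' := by
    rintro g ⟨g1, g2, g3⟩
    have hr : ∀ (X : Triple k K Ω) x, (g X).1 ((g⁻¹ X).1 x) = x := fun X x => by
      change ((g X).1 * ((g X)⁻¹).1) x = x
      simp
    have hl : ∀ (X : Triple k K Ω) x, (g⁻¹ X).1 ((g X).1 x) = x := fun X x => by
      change (((g X)⁻¹).1 * (g X).1) x = x
      simp
    refine ⟨fun X Y φ x => ?_, fun X Y x => ?_, by simp [g3]⟩
    · rw [← hl Y (φ.b.baseChange R ((g⁻¹ X).1 x)), g1, hr]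
    · have key := g2 X Y ((g⁻¹ (X.tensor Y)).1 x)
      have hr' := hr (X.tensor Y) x
      rw [hr'] at key
      rw [key]
      generalize AlgebraTensorModule.distribBaseChange k R X.W Y.W
        ((g⁻¹ (X.tensor Y)).1 x) = z
      have : TensorProduct.map (g⁻¹ X).1 (g⁻¹ Y).1 ∘ₗ TensorProduct.map (g X).1 (g Y).1
          = LinearMap.id := by
        refine TensorProduct.ext' fun a b => ?_
        simp only [LinearMap.comp_apply, TensorProduct.map_tmul, hl, LinearMap.id_apply]
      exact (LinearMap.congr_fun this z).symm

variable {k} in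
lemma distrib_extend_symm {R S : Type u} [CommRing R] [Algebra k R] [CommRing S] [Algebra k S]
    (f : R →ₐ[k] S) (W W' : Type u) [AddCommGroup W] [Module k W] [AddCommGroup W'] [Module k W']
    (x : R ⊗[k] W) (y : R ⊗[k] W') :
    AlgebraTensorModule.distribBaseChange k S W W'
      (extend (W ⊗[k] W') f ((AlgebraTensorModule.distribBaseChange k R W W').symm (x ⊗ₜ y))) =
      extend W f x ⊗ₜ extend W' f y := by
  induction x with
  | zero => simp
  | add a b ha hb => simp only [TensorProduct.add_tmul, map_add, ha, hb]
  | tmul r w =>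
    induction y with
    | zero => simp
    | add a b ha hb => simp only [TensorProduct.tmul_add, map_add, ha, hb]
    | tmul r' w' =>
      have h1 : (AlgebraTensorModule.distribBaseChange k R W W').symm
          ((r ⊗ₜ[k] w) ⊗ₜ[R] (r' ⊗ₜ[k] w')) = (r * r') ⊗ₜ[k] (w ⊗ₜ[k] w') := by
        rw [LinearEquiv.symm_apply_eq, AlgebraTensorModule.distribBaseChange_tmul]
        rw [mul_comm, show (r' * r) ⊗ₜ[k] w = r' • (r ⊗ₜ[k] w) by
          simp [TensorProduct.smul_tmul'], TensorProduct.smul_tmul]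
        simp [TensorProduct.smul_tmul']
      rw [h1, extend_tmul, extend_tmul, extend_tmul,
        AlgebraTensorModule.distribBaseChange_tmul, map_mul, mul_comm,
        show (f r' * f r) ⊗ₜ[k] w = f r' • (f r ⊗ₜ[k] w) by
          simp [TensorProduct.smul_tmul'], TensorProduct.smul_tmul]
      simp [TensorProduct.smul_tmul']

variable {k} in
lemma distrib_extend {R S : Type u} [CommRing R] [Algebra k R] [CommRing S] [Algebra k S]
    (f : R →ₐ[k] S) (W W' : Type u) [AddCommGroup W] [Module k W] [AddCommGroup W'] [Module k W']
    (e : Module.End R (R ⊗[k] (W ⊗[k] W'))) (a : Module.End R (R ⊗[k] W))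
    (b : Module.End R (R ⊗[k] W'))
    (h : ∀ x, AlgebraTensorModule.distribBaseChange k R W W' (e x) =
      TensorProduct.map a b (AlgebraTensorModule.distribBaseChange k R W W' x))
    (x : S ⊗[k] (W ⊗[k] W')) :
    AlgebraTensorModule.distribBaseChange k S W W' (endMap f e x) =
      TensorProduct.map (endMap f a) (endMap f b)
        (AlgebraTensorModule.distribBaseChange k S W W' x) := by
  suffices H : (AlgebraTensorModule.distribBaseChange k S W W').toLinearMap ∘ₗ endMap f e =
      TensorProduct.map (endMap f a) (endMap f b) ∘ₗ
        (AlgebraTensorModule.distribBaseChange k S W W').toLinearMap from LinearMap.congr_fun H x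
  apply TensorProduct.AlgebraTensorModule.curry_injective
  ext w w'
  have h' : e (1 ⊗ₜ (w ⊗ₜ w')) = (AlgebraTensorModule.distribBaseChange k R W W').symm
      (a (1 ⊗ₜ w) ⊗ₜ b (1 ⊗ₜ w')) := by
    rw [LinearEquiv.eq_symm_apply, h, AlgebraTensorModule.distribBaseChange_tmul,
      TensorProduct.map_tmul]
  have h2 : AlgebraTensorModule.distribBaseChange k S W W' (endMap f e (1 ⊗ₜ (w ⊗ₜ w'))) =
      TensorProduct.map (endMap f a) (endMap f b)
        (AlgebraTensorModule.distribBaseChange k S W W' (1 ⊗ₜ (w ⊗ₜ w'))) := by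
    rw [endMap_one_tmul, h', distrib_extend_symm, AlgebraTensorModule.distribBaseChange_tmul,
      TensorProduct.map_tmul, endMap_one_tmul, endMap_one_tmul]
  exact h2

lemma baseChange_extend {R S : Type u} [CommRing R] [Algebra k R] [CommRing S] [Algebra k S]
    (f : R →ₐ[k] S) {W W' : Type u} [AddCommGroup W] [Module k W] [AddCommGroup W'] [Module k W']
    (b : W →ₗ[k] W') (x : R ⊗[k] W) :
    b.baseChange S (extend W f x) = extend W' f (b.baseChange R x) := by
  induction x with
  | zero => simp
  | add a b ha hb => simp only [map_add, ha, hb]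
  | tmul r w => simp

/-- The map `Aut^⊗(ω_R) → Aut^⊗(ω_S)` given by base change along `f : R → S`. -/
def tensorAutMap {R S : Type u} [CommRing R] [Algebra k R] [CommRing S] [Algebra k S]
    (f : R →ₐ[k] S) : tensorAut k K Ω R →* tensorAut k K Ω S where
  toFun g := ⟨fun X => Units.map (endMap f) (g.1 X), by
    obtain ⟨g, g1, g2, g3⟩ := g
    refine ⟨fun X Y φ x => ?_, fun X Y x => ?_, ?_⟩
    · suffices H : endMap f (g Y).1 ∘ₗ φ.b.baseChange S = φ.b.baseChange S ∘ₗ endMap f (g X).1 from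
        LinearMap.congr_fun H x
      apply TensorProduct.AlgebraTensorModule.curry_injective
      ext w
      have : endMap f (g Y).1 (φ.b.baseChange S (1 ⊗ₜ w)) =
          φ.b.baseChange S (endMap f (g X).1 (1 ⊗ₜ w)) := by
        rw [endMap_one_tmul, baseChange_extend, ← g1]
        simp [endMap_one_tmul]
      exact this
    · exact distrib_extend f X.W Y.W _ _ _ (g2 X Y) x
    · simp only [g3]
      exact map_one _⟩
  map_one' := by
    ext1; funext X; exact map_one _
  map_mul' g h := by
    ext1; funext X; exact map_mul _ _ _

/-- The Tannakian group scheme of the category of triples with respect to the fibre functor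
`(V, W, ψ) ↦ W`, as a functor of points on commutative `k`-algebras. -/
def tannakaGroup : CommAlgCat.{u} k ⥤ GrpCat.{u + 1} where
  obj R := GrpCat.of (tensorAut k K Ω R)
  map f := GrpCat.ofHom (tensorAutMap k K Ω f.hom)
  map_id R := by
    refine GrpCat.hom_ext (MonoidHom.ext fun g => Subtype.ext (funext fun X => ?_))
    exact Units.ext (endMap_id _)
  map_comp f g := by
    refine GrpCat.hom_ext (MonoidHom.ext fun x => Subtype.ext (funext fun X => ?_))
    exact Units.ext (endMap_comp _ _ _)

end Tannaka

/-! ## Functoriality in the field -/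

section Pullback

variable {k K Ω : Type u} [Field k] [Field K] [Field Ω] [Algebra k Ω] [Algebra K Ω]
  (L Ω' : Type u) [Field L] [Field Ω'] [Algebra k Ω'] [Algebra L Ω'] [Algebra K L]
  [Algebra K Ω'] [IsScalarTower K L Ω'] [Algebra Ω Ω'] [IsScalarTower K Ω Ω']
  [IsScalarTower k Ω Ω']

namespace Triple

/-- The pullback functor `(V, W, ψ) ↦ (L ⊗_K V, W, Ω' ⊗_Ω ψ)` on objects, with the canonical
identifications `Ω' ⊗_L (L ⊗_K V) ≃ Ω' ⊗_K V ≃ Ω' ⊗_Ω (Ω ⊗_K V)` and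
`Ω' ⊗_Ω (Ω ⊗_k W) ≃ Ω' ⊗_k W`. -/
abbrev pullback (X : Triple k K Ω) : Triple k L Ω' where
  V := L ⊗[K] X.V
  W := X.W
  ψ := AlgebraTensorModule.cancelBaseChange K L Ω' Ω' X.V ≪≫ₗ
    (AlgebraTensorModule.cancelBaseChange K Ω Ω' Ω' X.V).symm ≪≫ₗ
    X.ψ.baseChange Ω Ω' _ _ ≪≫ₗ
    AlgebraTensorModule.cancelBaseChange k Ω Ω' Ω' X.W

lemma pullback_ψ (X : Triple k K Ω) (v : X.V) :
    (X.pullback L Ω').ψ (1 ⊗ₜ (1 ⊗ₜ v)) =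
      extend X.W (IsScalarTower.toAlgHom k Ω Ω') (X.ψ (1 ⊗ₜ v)) := by
  have h : ∀ y : Ω ⊗[k] X.W, AlgebraTensorModule.cancelBaseChange k Ω Ω' Ω' X.W (1 ⊗ₜ y) =
      extend X.W (IsScalarTower.toAlgHom k Ω Ω') y := fun y => by
    induction y with
    | zero => simp
    | add a b ha hb => simp only [TensorProduct.tmul_add, map_add, ha, hb]
    | tmul r w => simp [Algebra.smul_def]
  rw [← h]
  simp

/-- Two linear maps out of `Ω' ⊗_L (L ⊗_K V)` that agree on the elements `1 ⊗ 1 ⊗ v` agree. -/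
lemma pullback_ext {V M : Type u} [AddCommGroup V] [Module K V] [AddCommGroup M] [Module Ω' M]
    (f g : Ω' ⊗[L] (L ⊗[K] V) →ₗ[Ω'] M)
    (h : ∀ v : V, f (1 ⊗ₜ (1 ⊗ₜ v)) = g (1 ⊗ₜ (1 ⊗ₜ v))) (x : Ω' ⊗[L] (L ⊗[K] V)) :
    f x = g x := by
  induction x with
  | zero => simp
  | add a b ha hb => simp only [map_add, ha, hb]
  | tmul r y =>
    induction y with
    | zero => simp
    | add a b ha hb => simp only [TensorProduct.tmul_add, map_add, ha, hb]
    | tmul l v =>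
      have e : r ⊗ₜ[L] (l ⊗ₜ[K] v) = (r * algebraMap L Ω' l) • ((1 : Ω') ⊗ₜ[L] ((1 : L) ⊗ₜ[K] v)) := by
        rw [TensorProduct.smul_tmul', smul_eq_mul, mul_one,
          show r * algebraMap L Ω' l = l • r by rw [Algebra.smul_def, mul_comm],
          TensorProduct.smul_tmul, TensorProduct.smul_tmul', smul_eq_mul, mul_one]
      rw [e, map_smul, map_smul, h]

/-- The pullback functor on morphisms. -/
def pullbackHom {X Y : Triple k K Ω} (φ : X ⟶ Y) : X.pullback L Ω' ⟶ Y.pullback L Ω' where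
  a := φ.a.baseChange L
  b := φ.b
  comm := pullback_ext L Ω'
    ((Y.pullback L Ω').ψ.toLinearMap ∘ₗ (φ.a.baseChange L).baseChange Ω')
    (φ.b.baseChange Ω' ∘ₗ (X.pullback L Ω').ψ.toLinearMap) fun v => by
      have h1 := pullback_ψ L Ω' Y (φ.a v)
      have h2 := pullback_ψ L Ω' X v
      have h3 := φ.comm (1 ⊗ₜ v)
      rw [LinearMap.baseChange_tmul] at h3
      rw [LinearMap.comp_apply, LinearMap.comp_apply, LinearMap.baseChange_tmul,
        LinearMap.baseChange_tmul, LinearEquiv.coe_coe, LinearEquiv.coe_coe]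
      erw [h1, h2]
      rw [h3, baseChange_extend]

/-- The pullback functor is compatible with tensor products. -/
def pullbackTensor (X Y : Triple k K Ω) :
    (X.tensor Y).pullback L Ω' ⟶ (X.pullback L Ω').tensor (Y.pullback L Ω') where
  a := (AlgebraTensorModule.distribBaseChange K L X.V Y.V).toLinearMap
  b := LinearMap.id
  comm := pullback_ext L Ω'
    (((X.pullback L Ω').tensor (Y.pullback L Ω')).ψ.toLinearMap ∘ₗ
      (AlgebraTensorModule.distribBaseChange K L X.V Y.V).toLinearMap.baseChange Ω')
    (LinearMap.id.baseChange Ω' ∘ₗ ((X.tensor Y).pullback L Ω').ψ.toLinearMap) fun v => by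
      rw [LinearMap.comp_apply, LinearMap.comp_apply, LinearMap.baseChange_tmul,
        LinearEquiv.coe_coe, LinearEquiv.coe_coe, LinearEquiv.coe_coe, LinearMap.baseChange_id,
        LinearMap.id_apply, pullback_ψ]
      induction v with
      | zero => simp only [TensorProduct.tmul_zero, map_zero]
      | add a b ha hb => simp only [TensorProduct.tmul_add, map_add, ha, hb]
      | tmul v w =>
        rw [tensor_ψ, AlgebraTensorModule.distribBaseChange_tmul]
        erw [tensor_ψ, pullback_ψ, pullback_ψ]
        rw [LinearEquiv.symm_apply_eq, distrib_extend_symm]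

/-- The pullback functor is compatible with unit objects. -/
def pullbackUnit : (unit k K Ω).pullback L Ω' ⟶ unit k L Ω' where
  a := (AlgebraTensorModule.rid K L L).toLinearMap
  b := LinearMap.id
  comm := pullback_ext L Ω'
    ((unit k L Ω').ψ.toLinearMap ∘ₗ (AlgebraTensorModule.rid K L L).toLinearMap.baseChange Ω')
    (LinearMap.id.baseChange Ω' ∘ₗ ((unit k K Ω).pullback L Ω').ψ.toLinearMap) fun v => by
      rw [LinearMap.comp_apply, LinearMap.comp_apply, LinearMap.baseChange_tmul,
        LinearEquiv.coe_coe, LinearEquiv.coe_coe, LinearEquiv.coe_coe, LinearMap.baseChange_id,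
        LinearMap.id_apply, pullback_ψ]
      simp [Algebra.smul_def, ← IsScalarTower.algebraMap_apply]

end Triple

/-- The homomorphism of Tannakian groups induced by the pullback functor. -/
def tannakaMap : tannakaGroup k L Ω' ⟶ tannakaGroup k K Ω where
  app R := GrpCat.ofHom
    { toFun g := ⟨fun X => g.1 (X.pullback L Ω'), by
        obtain ⟨g, g1, g2, g3⟩ := g
        refine ⟨fun X Y φ x => g1 _ _ (Triple.pullbackHom L Ω' φ) x, fun X Y x => ?_, ?_⟩
        · have h := g1 _ _ (Triple.pullbackTensor L Ω' X Y) x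
          have h2 := g2 (X.pullback L Ω') (Y.pullback L Ω') x
          simp only [Triple.pullbackTensor, LinearMap.baseChange_id, LinearMap.id_apply] at h
          rw [← h2]
          exact congrArg _ h.symm
        · refine Units.ext (LinearMap.ext fun x => ?_)
          have h := g1 _ _ (Triple.pullbackUnit (k := k) (K := K) (Ω := Ω) L Ω') x
          simp only [Triple.pullbackUnit, LinearMap.baseChange_id, LinearMap.id_apply, g3] at h
          exact h.symm⟩
      map_one' := rfl
      map_mul' _ _ := rfl }
  naturality _ _ _ := rfl

end Pullback

/-! ## The local Nori fundamental group -/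

section Perf

variable (p : ℕ) [Fact p.Prime]

/-- The perfect closure of `K` as an algebra over every subfield of `K`. -/
instance perfectClosureAlgebra (A K : Type u) [Field A] [Field K] [CharP K p] [Algebra A K] :
    Algebra A (PerfectClosure K p) :=
  ((PerfectClosure.of K p).comp (algebraMap A K)).toAlgebra

lemma perfectClosure_algebraMap (A K : Type u) [Field A] [Field K] [CharP K p] [Algebra A K]
    (a : A) : algebraMap A (PerfectClosure K p) a = PerfectClosure.of K p (algebraMap A K a) :=
  rfl

variable (k K L : Type u) [Field k] [Field K] [CharP K p] [Field L] [CharP L p]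
  [Algebra k K] [Algebra k L] [Algebra K L] [IsScalarTower k K L]

/-- The map `K^perf → L^perf` extending `K → L`. -/
def perfectClosureMap : PerfectClosure K p →+* PerfectClosure L p :=
  PerfectClosure.lift K p (PerfectClosure L p) ((PerfectClosure.of L p).comp (algebraMap K L))

lemma perfectClosureMap_of (x : K) :
    perfectClosureMap p K L (PerfectClosure.of K p x) =
      PerfectClosure.of L p (algebraMap K L x) :=
  RingHom.congr_fun ((PerfectClosure.lift K p (PerfectClosure L p)).symm_apply_apply
    ((PerfectClosure.of L p).comp (algebraMap K L))) x

/-- The local Nori fundamental group `π^L(K/k)`: the Tannakian group scheme of the category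
`𝒟_∞(K/k)` of triples `(V, W, ψ : K^perf ⊗_K V ≃ K^perf ⊗_k W)`, as a functor of points. -/
def localNoriGroup : CommAlgCat.{u} k ⥤ GrpCat.{u + 1} :=
  tannakaGroup k K (PerfectClosure K p)

/-- The homomorphism `π^L(L/k) → π^L(K/k)` induced by a field extension `L/K` over `k`. -/
def localNoriGroupMap : localNoriGroup p k L ⟶ localNoriGroup p k K :=
  letI : Algebra (PerfectClosure K p) (PerfectClosure L p) := (perfectClosureMap p K L).toAlgebra
  haveI : IsScalarTower K L (PerfectClosure L p) := IsScalarTower.of_algebraMap_eq fun _ => rfl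
  haveI : IsScalarTower K (PerfectClosure K p) (PerfectClosure L p) :=
    IsScalarTower.of_algebraMap_eq fun x => (perfectClosureMap_of p K L x).symm
  haveI : IsScalarTower k (PerfectClosure K p) (PerfectClosure L p) :=
    IsScalarTower.of_algebraMap_eq fun x => by
      rw [perfectClosure_algebraMap, IsScalarTower.algebraMap_apply k K L]
      exact (perfectClosureMap_of p K L _).symm
  tannakaMap L (PerfectClosure L p)

end Perf

/-! ## Subgroups and quotients of group functors -/

section GroupFunctor

variable {k : Type u} [Field k]

/-- A closed subgroup functor of a group functor `G` on commutative `k`-algebras: for every point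
`g ∈ G(R)` the condition that `g` lies in the subgroup is represented by a closed subscheme
`Spec (R/I)` of `Spec R`. For an affine group scheme these are its closed subgroup schemes. -/
structure ClosedSubgroup (G : CommAlgCat.{u} k ⥤ GrpCat.{u + 1}) where
  carrier : ∀ R : CommAlgCat.{u} k, Subgroup (G.obj R)
  map_mem : ∀ {R S : CommAlgCat.{u} k} (f : R ⟶ S) (g : G.obj R),
    g ∈ carrier R → G.map f g ∈ carrier S
  closed : ∀ (R : CommAlgCat.{u} k) (g : G.obj R), ∃ I : Ideal R,
    ∀ (S : CommAlgCat.{u} k) (f : R ⟶ S), G.map f g ∈ carrier S ↔ ∀ a ∈ I, f.hom a = 0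

/-- The image of a homomorphism of group functors, a family of subgroups of the target. -/
def imageSubgroup {G' G : CommAlgCat.{u} k ⥤ GrpCat.{u + 1}} (φ : G' ⟶ G)
    (R : CommAlgCat.{u} k) : Subgroup (G.obj R) := (φ.app R).hom.range

/-- The `k`-algebra of global functions on the quotient `G/H`: natural transformations
from `G` to the affine line that are invariant under right translation by `H`. -/
def quotientFunctions (G : CommAlgCat.{u} k ⥤ GrpCat.{u + 1})
    (H : ∀ R : CommAlgCat.{u} k, Subgroup (G.obj R)) :
    Subalgebra k (∀ R : CommAlgCat.{u} k, G.obj R → R) where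
  carrier := {F |
    (∀ (R S : CommAlgCat.{u} k) (f : R ⟶ S) (g : G.obj R), F S (G.map f g) = f.hom (F R g)) ∧
    ∀ (R : CommAlgCat.{u} k) (g h : G.obj R), h ∈ H R → F R (g * h) = F R g}
  mul_mem' := by
    rintro a b ⟨ha, ha'⟩ ⟨hb, hb'⟩
    exact ⟨fun R S f g => by simp [ha, hb], fun R g h hh => by simp [ha' R g h hh, hb' R g h hh]⟩
  add_mem' := by
    rintro a b ⟨ha, ha'⟩ ⟨hb, hb'⟩
    exact ⟨fun R S f g => by simp [ha, hb], fun R g h hh => by simp [ha' R g h hh, hb' R g h hh]⟩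
  algebraMap_mem' c := ⟨fun R S f g => by simp [Pi.algebraMap_apply], fun R g h hh => rfl⟩

/-- `q : G → Spec B` exhibits the affine `k`-scheme `Spec B` as the quotient `G/H` in the sense of
fpqc sheaves: the fibres of `q` are the cosets `gH`, and every point of `Spec B` lifts to `G`
after a faithfully flat extension. -/
structure IsQuotientMap (G : CommAlgCat.{u} k ⥤ GrpCat.{u + 1})
    (H : ∀ R : CommAlgCat.{u} k, Subgroup (G.obj R)) (B : CommAlgCat.{u} k)
    (q : ∀ R : CommAlgCat.{u} k, G.obj R → (B ⟶ R)) : Prop where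
  natural : ∀ (R S : CommAlgCat.{u} k) (f : R ⟶ S) (g : G.obj R), q S (G.map f g) = q R g ≫ f
  eq_iff : ∀ (R : CommAlgCat.{u} k) (g g' : G.obj R), q R g = q R g' ↔ g⁻¹ * g' ∈ H R
  locally_surjective : ∀ (R : CommAlgCat.{u} k) (x : B ⟶ R),
    ∃ (S : CommAlgCat.{u} k) (f : R ⟶ S), f.hom.toRingHom.FaithfullyFlat ∧
      ∃ g : G.obj S, q S g = x ≫ f

/-- The quotient `G/H` is a finite `k`-scheme, that is, the spectrum of a finite `k`-algebra. -/
def QuotientIsFinite (G : CommAlgCat.{u} k ⥤ GrpCat.{u + 1})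
    (H : ∀ R : CommAlgCat.{u} k, Subgroup (G.obj R)) : Prop :=
  ∃ (B : CommAlgCat.{u} k) (q : ∀ R : CommAlgCat.{u} k, G.obj R → (B ⟶ R)),
    Module.Finite k B ∧ IsQuotientMap G H B q

end GroupFunctor

/-- The quotient `L^* / K^*` of unit groups. -/
abbrev unitsQuotient (K L : Type u) [CommRing K] [CommRing L] [Algebra K L] : Type u :=
  Lˣ ⧸ (Units.map (algebraMap K L).toMonoidHom).range

end LocalNori

end

/-! Everything is detected by the characters χ_u of the rank one triples (K, k, u), where u is a
unit of Ω = K^perf. Two k-algebra maps Ω → T that agree on K give a T-point of the group (`point`);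
the two inclusions of Ω into Ω ⊗_K Ω give the universal such point, on which χ_u takes the value u⁻¹
⊗ u. By faithfully flat descent (`mem_range_of_tmul_one_eq`), χ_u = χ_v forces u/v ∈ K, and a
character χ_u that is trivial on π(L) has u ∈ L; conversely u ∈ L makes χ_u trivial on π(L).

For the first claim take α ∈ K^perf \ K with α^p ∈ K, and H = ker χ_α. If H came from L, then α ∈ L,
so 1 + α ∈ L and χ_{1+α} would be trivial on H. Additive closure of L is thus the obstruction:
`exists_character_eq_one_and_ne_one` produces a point of H on which χ_{1+α} is not 1.

For the second claim take an element of L outside K, coming from α ∈ K^perf. The characters of 1 +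
aα, for a in the infinite field K, are trivial on π(L) and pairwise distinct, hence linearly
independent (`linearIndependent_characters`). So the functions on the quotient are infinite
dimensional, whereas on a finite quotient they are finite dimensional by descent
(`finite_quotientFunctions`).

The third claim uses the same elements 1 + aα, now as classes in L^*/K^*. They are distinct, and the
group is killed by p, so finite generation would make it finite. -/

noncomputable section

namespace LocalNori

/-! ### Points of the Tannakian group from pairs of maps out of Ω -/

section Points

variable {k K Ω : Type u} [Field k] [Field K] [Field Ω] [Algebra k Ω] [Algebra K Ω]

lemma cancelBaseChange_one_tmul {W T : Type u} [AddCommGroup W] [Module k W] [CommRing T]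
    [Algebra k T] [Algebra Ω T] [IsScalarTower k Ω T] (y : Ω ⊗[k] W) :
    AlgebraTensorModule.cancelBaseChange k Ω T T W (1 ⊗ₜ y) =
      extend W (IsScalarTower.toAlgHom k Ω T) y := by
  induction y with
  | zero => simp
  | add a b ha hb => simp only [TensorProduct.tmul_add, map_add, ha, hb]
  | tmul r w => simp [Algebra.smul_def]

namespace Triple

/-- The isomorphism `T ⊗_K V ≃ T ⊗_k W` obtained from `ψ` by base change to an `Ω`-algebra. -/
def ψBaseChange (X : Triple k K Ω) (T : Type u) [CommRing T] [Algebra k T] [Algebra K T]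
    [Algebra Ω T] [IsScalarTower K Ω T] [IsScalarTower k Ω T] :
    T ⊗[K] X.V ≃ₗ[T] T ⊗[k] X.W :=
  (AlgebraTensorModule.cancelBaseChange K Ω T T X.V).symm ≪≫ₗ X.ψ.baseChange Ω T _ _ ≪≫ₗ
    AlgebraTensorModule.cancelBaseChange k Ω T T X.W

lemma ψBaseChange_one_tmul (X : Triple k K Ω) (T : Type u) [CommRing T] [Algebra k T]
    [Algebra K T] [Algebra Ω T] [IsScalarTower K Ω T] [IsScalarTower k Ω T] (v : X.V) :
    X.ψBaseChange T (1 ⊗ₜ v) = extend X.W (IsScalarTower.toAlgHom k Ω T) (X.ψ (1 ⊗ₜ v)) := by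
  rw [← cancelBaseChange_one_tmul]
  simp [ψBaseChange]

variable {T : Type u} [CommRing T] [Algebra k T] [Algebra K T]

/-- The isomorphism `T ⊗_K V ≃ T ⊗_k W` obtained from `ψ` by base change along `f : Ω → T`. -/
def ψAlong (X : Triple k K Ω) (f : Ω →ₐ[k] T)
    (hf : ∀ a : K, algebraMap K T a = f (algebraMap K Ω a)) : T ⊗[K] X.V ≃ₗ[T] T ⊗[k] X.W :=
  letI : Algebra Ω T := f.toRingHom.toAlgebra
  haveI : IsScalarTower K Ω T := IsScalarTower.of_algebraMap_eq hf
  haveI : IsScalarTower k Ω T := IsScalarTower.of_algebraMap_eq fun x => (f.commutes x).symm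
  X.ψBaseChange T

lemma ψAlong_one_tmul (X : Triple k K Ω) (f : Ω →ₐ[k] T)
    (hf : ∀ a : K, algebraMap K T a = f (algebraMap K Ω a)) (v : X.V) :
    X.ψAlong f hf (1 ⊗ₜ v) = extend X.W f (X.ψ (1 ⊗ₜ v)) := by
  let : Algebra Ω T := f.toRingHom.toAlgebra
  have : IsScalarTower K Ω T := IsScalarTower.of_algebraMap_eq hf
  have : IsScalarTower k Ω T := IsScalarTower.of_algebraMap_eq fun x => (f.commutes x).symm
  exact X.ψBaseChange_one_tmul T v

/-- Linear maps out of `T ⊗_k W` that agree on the vectors coming from `V` agree. -/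
lemma ext_along (X : Triple k K Ω) (f : Ω →ₐ[k] T)
    (hf : ∀ a : K, algebraMap K T a = f (algebraMap K Ω a)) {M : Type*} [AddCommGroup M]
    [Module T M] {l l' : T ⊗[k] X.W →ₗ[T] M}
    (h : ∀ v, l (extend X.W f (X.ψ (1 ⊗ₜ v))) = l' (extend X.W f (X.ψ (1 ⊗ₜ v)))) : l = l' := by
  ext1 x
  obtain ⟨y, rfl⟩ := (X.ψAlong f hf).surjective x
  induction y with
  | zero => simp
  | add a b ha hb => simp only [map_add, ha, hb]
  | tmul r v =>
    have e : (r ⊗ₜ[K] v : T ⊗[K] X.V) = r • ((1 : T) ⊗ₜ[K] v) := by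
      simp [TensorProduct.smul_tmul']
    rw [e, map_smul, ψAlong_one_tmul, map_smul, map_smul, h]

variable (f₁ f₂ : Ω →ₐ[k] T) (h₁ : ∀ a : K, algebraMap K T a = f₁ (algebraMap K Ω a))
  (h₂ : ∀ a : K, algebraMap K T a = f₂ (algebraMap K Ω a))

/-- The automorphism of `T ⊗_k W` comparing the base changes of `ψ` along `f₁` and `f₂`. -/
def compare (X : Triple k K Ω) : LinearMap.GeneralLinearGroup T (T ⊗[k] X.W) :=
  LinearMap.GeneralLinearGroup.ofLinearEquiv ((X.ψAlong f₁ h₁).symm ≪≫ₗ X.ψAlong f₂ h₂)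

/-- The vectors ψ(1 ⊗ v), pushed along f₁, span T ⊗ W, so this formula determines the automorphism.
-/
lemma compare_apply (X : Triple k K Ω) (v : X.V) :
    (X.compare f₁ f₂ h₁ h₂).1 (extend X.W f₁ (X.ψ (1 ⊗ₜ v))) =
      extend X.W f₂ (X.ψ (1 ⊗ₜ v)) := by
  rw [← ψAlong_one_tmul X f₁ h₁, ← ψAlong_one_tmul X f₂ h₂]
  change X.ψAlong f₂ h₂ ((X.ψAlong f₁ h₁).symm _) = _
  rw [LinearEquiv.symm_apply_apply]

end Triple

variable {T : Type u} [CommRing T] [Algebra k T] [Algebra K T]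

open Triple in
/-- Two `k`-algebra maps `Ω → T` that agree on `K` give a tensor automorphism of `ω_T`. -/
def point (f₁ f₂ : Ω →ₐ[k] T) (h₁ : ∀ a : K, algebraMap K T a = f₁ (algebraMap K Ω a))
    (h₂ : ∀ a : K, algebraMap K T a = f₂ (algebraMap K Ω a)) : tensorAut k K Ω T :=
  ⟨fun X => X.compare f₁ f₂ h₁ h₂, by
    -- Each identity is T-linear, so `ext_along` reduces it to vectors coming from V, on which the
    -- automorphism only exchanges f₁ for f₂.
    refine ⟨fun X Y φ x => ?_, fun X Y x => ?_, ?_⟩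
    · suffices H : (Y.compare f₁ f₂ h₁ h₂).1 ∘ₗ φ.b.baseChange T =
          φ.b.baseChange T ∘ₗ (X.compare f₁ f₂ h₁ h₂).1 from LinearMap.congr_fun H x
      refine X.ext_along f₁ h₁ fun v => ?_
      have h := φ.comm (1 ⊗ₜ v)
      rw [LinearMap.baseChange_tmul] at h
      rw [LinearMap.comp_apply, LinearMap.comp_apply, compare_apply, baseChange_extend,
        baseChange_extend, ← h, compare_apply]
    · suffices H : (AlgebraTensorModule.distribBaseChange k T X.W Y.W).toLinearMap ∘ₗ
          ((X.tensor Y).compare f₁ f₂ h₁ h₂).1 =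
          TensorProduct.map (X.compare f₁ f₂ h₁ h₂).1 (Y.compare f₁ f₂ h₁ h₂).1 ∘ₗ
            (AlgebraTensorModule.distribBaseChange k T X.W Y.W).toLinearMap from
        LinearMap.congr_fun H x
      refine ext_along (M := (T ⊗[k] X.W) ⊗[T] (T ⊗[k] Y.W)) (X.tensor Y) f₁ h₁ fun v => ?_
      rw [LinearMap.comp_apply, LinearMap.comp_apply, compare_apply]
      induction v using TensorProduct.induction_on with
      | zero => simp only [TensorProduct.tmul_zero, map_zero]
      | add a b ha hb => simp only [TensorProduct.tmul_add, map_add, ha, hb]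
      | tmul v w =>
        rw [tensor_ψ, LinearEquiv.coe_coe, distrib_extend_symm, distrib_extend_symm,
          TensorProduct.map_tmul, compare_apply, compare_apply]
    · refine Units.ext ((Triple.unit k K Ω).ext_along f₁ h₁ fun v => ?_)
      rw [compare_apply]
      simp [Algebra.smul_def, ← h₁, ← h₂]⟩

lemma point_apply (f₁ f₂ : Ω →ₐ[k] T) (h₁ : ∀ a : K, algebraMap K T a = f₁ (algebraMap K Ω a))
    (h₂ : ∀ a : K, algebraMap K T a = f₂ (algebraMap K Ω a)) (X : Triple k K Ω) (v : X.V) :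
    ((point f₁ f₂ h₁ h₂).1 X).1 (extend X.W f₁ (X.ψ (1 ⊗ₜ v))) =
      extend X.W f₂ (X.ψ (1 ⊗ₜ v)) := X.compare_apply f₁ f₂ h₁ h₂ v

end Points

/-! ### Rank one triples and their characters -/

section Characters

variable {k K Ω : Type u} [Field k] [Field K] [Field Ω] [Algebra k Ω] [Algebra K Ω]

/-- The rank one triple `(K, k, u)`. -/
abbrev Triple.line (k K : Type u) {Ω : Type u} [Field k] [Field K] [Field Ω] [Algebra k Ω]
    [Algebra K Ω] (u : Ωˣ) : Triple k K Ω where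
  V := K
  W := k
  ψ := AlgebraTensorModule.rid K Ω Ω ≪≫ₗ LinearEquiv.smulOfUnit u ≪≫ₗ
    (AlgebraTensorModule.rid k Ω Ω).symm

lemma Triple.line_ψ (u : Ωˣ) :
    (Triple.line k K u).ψ ((1 : Ω) ⊗ₜ[K] (1 : K)) = (u : Ω) ⊗ₜ[k] (1 : k) := by
  change (AlgebraTensorModule.rid k Ω Ω).symm (u • AlgebraTensorModule.rid K Ω Ω (1 ⊗ₜ 1)) = _
  simp [Units.smul_def]

/-- The scalar by which an endomorphism of `R ⊗_k k` acts. -/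
def endScalar {R : Type u} [CommRing R] [Algebra k R] (e : Module.End R (R ⊗[k] k)) : R :=
  AlgebraTensorModule.rid k R R (e (1 ⊗ₜ 1))

lemma endScalar_spec {R : Type u} [CommRing R] [Algebra k R] (e : Module.End R (R ⊗[k] k))
    (r : R) : e (r ⊗ₜ 1) = (r * endScalar e) ⊗ₜ 1 := by
  have h : e (1 ⊗ₜ 1) = endScalar e ⊗ₜ 1 := by
    apply (AlgebraTensorModule.rid k R R).injective
    simp [endScalar]
  have h1 : (r ⊗ₜ[k] (1 : k) : R ⊗[k] k) = r • ((1 : R) ⊗ₜ[k] 1) := by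
    simp [TensorProduct.smul_tmul']
  rw [h1, map_smul, h, TensorProduct.smul_tmul', smul_eq_mul]

lemma endScalar_eq {R : Type u} [CommRing R] [Algebra k R] {e : Module.End R (R ⊗[k] k)}
    {r s : R} (h : e (r ⊗ₜ 1) = s ⊗ₜ 1) : r * endScalar e = s := by
  rw [endScalar_spec] at h
  simpa using congrArg (AlgebraTensorModule.rid k R R) h

/-- The character of the Tannakian group on the rank one triple `(K, k, u)`. -/
def character (k K : Type u) {Ω : Type u} [Field k] [Field K] [Field Ω] [Algebra k Ω]
    [Algebra K Ω] (u : Ωˣ) (R : CommAlgCat.{u} k) (g : (tannakaGroup k K Ω).obj R) : R :=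
  endScalar (k := k) (R := R) (g.1 (Triple.line k K u)).1

lemma character_mul (u : Ωˣ) (R : CommAlgCat.{u} k) (g h : (tannakaGroup k K Ω).obj R) :
    character k K u R (g * h) = character k K u R g * character k K u R h := by
  have := endScalar_eq (k := k) (R := R)
    (e := ((g * h).1 (Triple.line k K u)).1) (r := 1)
    (s := character k K u R h * character k K u R g) (by
      change (g.1 (Triple.line k K u)).1 ((h.1 (Triple.line k K u)).1 (1 ⊗ₜ[k] (1 : k))) = _
      erw [endScalar_spec (k := k) (R := R), endScalar_spec (k := k) (R := R)]
      rw [one_mul]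
      rfl)
  rw [one_mul, mul_comm (character _ _ _ _ h)] at this
  exact this

lemma character_one (u : Ωˣ) (R : CommAlgCat.{u} k) :
    character k K u R (1 : (tannakaGroup k K Ω).obj R) = 1 := by
  have := endScalar_eq (k := k) (R := R) (e := 1) (r := 1) (s := 1) rfl
  rw [one_mul] at this
  exact this

lemma character_map (u : Ωˣ) (R S : CommAlgCat.{u} k) (f : R ⟶ S)
    (g : (tannakaGroup k K Ω).obj R) :
    character k K u S ((tannakaGroup k K Ω).map f g) = f.hom (character k K u R g) := by
  have := endScalar_eq (k := k) (R := S) (r := 1) (s := f.hom (character k K u R g))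
    (e := endMap (W := k) f.hom (g.1 (Triple.line k K u)).1) (by
      refine (endMap_one_tmul (W := k) f.hom _ _).trans ?_
      erw [endScalar_spec (k := k) (R := R)]
      rw [one_mul, extend_tmul]
      rfl)
  rw [one_mul] at this
  exact this

/-- Since ψ(1 ⊗ 1) = u ⊗ 1, comparing along f₁ and f₂ carries f₁(u) to f₂(u): the character is the
ratio f₂(u)/f₁(u). -/
lemma character_point {T : Type u} [CommRing T] [Algebra k T] [Algebra K T] (f₁ f₂ : Ω →ₐ[k] T)
    (h₁ : ∀ a : K, algebraMap K T a = f₁ (algebraMap K Ω a))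
    (h₂ : ∀ a : K, algebraMap K T a = f₂ (algebraMap K Ω a)) (u : Ωˣ) :
    f₁ u * character k K u (CommAlgCat.of k T) (point f₁ f₂ h₁ h₂) = f₂ u := by
  refine endScalar_eq (k := k) (R := T) ?_
  have h := point_apply f₁ f₂ h₁ h₂ (Triple.line k K u) (1 : K)
  erw [Triple.line_ψ] at h
  exact h

end Characters

/-! ### Independence of characters and functions on a finite quotient -/

section GroupFunctorFunctions

variable {k : Type u} [Field k] {G : CommAlgCat.{u} k ⥤ GrpCat.{u + 1}}

/-- Distinct characters of a group functor are linearly independent. -/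
theorem linearIndependent_characters {ι : Type*} (χ : ι → ∀ R : CommAlgCat.{u} k, G.obj R → R)
    (hmap : ∀ i (R S : CommAlgCat.{u} k) (f : R ⟶ S) (g : G.obj R),
      χ i S (G.map f g) = f.hom (χ i R g))
    (hmul : ∀ i (R : CommAlgCat.{u} k) (g h : G.obj R), χ i R (g * h) = χ i R g * χ i R h)
    (hone : ∀ i (R : CommAlgCat.{u} k), χ i R 1 = 1) (hinj : Function.Injective χ) :
    LinearIndependent k χ := by
  classical
  rw [linearIndependent_iff']
  intro s
  induction s using Finset.induction_on with
  | empty => simp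
  | insert a s ha ih =>
    intro c hc
    have rel : ∀ (R : CommAlgCat.{u} k) (g : G.obj R),
        c a • χ a R g + ∑ i ∈ s, c i • χ i R g = 0 := fun R g => by
      have := congrFun (congrFun hc R) g
      rw [Finset.sum_insert ha] at this
      simpa [Finset.sum_apply] using this
    have hs : ∀ i ∈ s, c i = 0 := by
      intro i hi
      by_contra hci
      have hne : χ i ≠ χ a := fun h => ha (hinj h ▸ hi)
      refine hne (funext fun S => funext fun h => ?_)
      rw [← sub_eq_zero]
      refine (Module.forall_dual_apply_eq_zero_iff k _).1 fun l => ?_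
      -- Artin's argument with points over different algebras. The relation at the product of g and
      -- h, pulled back to R ⊗ S, minus the relation at g tensored with χ_a(h), loses the term of a;
      -- the linear form l on S then turns the rest into a shorter relation with coefficients in k.
      have key := ih (fun j => c j * l (χ j S h - χ a S h)) (by
        funext R g
        let P : CommAlgCat.{u} k := CommAlgCat.of k (R ⊗[k] S)
        let i₁ : R ⟶ P := CommAlgCat.ofHom Algebra.TensorProduct.includeLeft
        let i₂ : S ⟶ P := CommAlgCat.ofHom Algebra.TensorProduct.includeRight
        have e : ∀ j, χ j P (G.map i₁ g * G.map i₂ h) = χ j R g ⊗ₜ[k] χ j S h := fun j => by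
          rw [hmul, hmap, hmap]
          change (χ j R g ⊗ₜ[k] (1 : S)) * ((1 : R) ⊗ₜ[k] χ j S h) = _
          simp
        have r1 : c a • (χ a R g ⊗ₜ[k] χ a S h) + ∑ j ∈ s, c j • (χ j R g ⊗ₜ[k] χ j S h) =
            (0 : R ⊗[k] S) := by
          have := rel P (G.map i₁ g * G.map i₂ h)
          simp only [e] at this
          exact this
        have r2 : (c a • χ a R g + ∑ j ∈ s, c j • χ j R g) ⊗ₜ[k] χ a S h = 0 := by
          rw [rel R g, TensorProduct.zero_tmul]
        rw [TensorProduct.add_tmul, TensorProduct.sum_tmul] at r2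
        have r3 : ∑ j ∈ s, c j • (χ j R g ⊗ₜ[k] (χ j S h - χ a S h)) = 0 := by
          have := sub_eq_zero_of_eq (r1.trans r2.symm)
          simp only [TensorProduct.smul_tmul'] at this ⊢
          rw [add_sub_add_left_eq_sub, ← Finset.sum_sub_distrib] at this
          rw [← this]
          exact Finset.sum_congr rfl fun j _ => TensorProduct.tmul_sub _ _ _
        have r4 := congrArg ((TensorProduct.rid k R).toLinearMap ∘ₗ l.lTensor R) r3
        simpa [Finset.sum_apply, mul_smul] using r4) i hi
      exact (mul_eq_zero.1 key).resolve_left hci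
    have h1 := rel (CommAlgCat.of k k) 1
    rw [Finset.sum_eq_zero fun i hi => by rw [hs i hi, zero_smul], hone, add_zero] at h1
    intro i hi
    rcases Finset.mem_insert.1 hi with rfl | hi
    · simpa using h1
    · exact hs i hi

variable {H : ∀ R : CommAlgCat.{u} k, Subgroup (G.obj R)}

/-- An invariant function depends only on the image under q, even after base change to a common
algebra; this supplies the descent data below. -/
lemma IsQuotientMap.map_eq {B : CommAlgCat.{u} k} {q : ∀ R : CommAlgCat.{u} k, G.obj R → (B ⟶ R)}
    (hq : IsQuotientMap G H B q) (F : quotientFunctions G H) {R S P : CommAlgCat.{u} k}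
    (g : G.obj R) (h : G.obj S) (i : R ⟶ P) (j : S ⟶ P) (hij : q R g ≫ i = q S h ≫ j) :
    i.hom (F.1 R g) = j.hom (F.1 S h) := by
  rw [← hq.natural, ← hq.natural, hq.eq_iff] at hij
  have := F.2.2 P (G.map i g) _ hij
  rw [mul_inv_cancel_left, F.2.1, F.2.1] at this
  exact this.symm

/-- The functions on a finite quotient form a finite dimensional space. -/
theorem finite_quotientFunctions (hfin : QuotientIsFinite G H) :
    Module.Finite k (quotientFunctions G H) := by
  obtain ⟨B, q, hB, hq⟩ := hfin
  -- The tautological point of Spec B lifts to g over a faithfully flat S. An invariant function is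
  -- determined by its value at g, and that value descends to B.
  obtain ⟨S, f, hf, g, hg⟩ := hq.locally_surjective B (𝟙 B)
  rw [Category.id_comp] at hg
  let _ : Algebra B S := f.hom.toRingHom.toAlgebra
  have hflat : Module.FaithfullyFlat B S := hf
  have : IsScalarTower k B S := IsScalarTower.of_algebraMap_eq fun x => (f.hom.commutes x).symm
  let E : quotientFunctions G H →ₗ[k] S :=
    { toFun F := F.1 S g
      map_add' _ _ := rfl
      map_smul' _ _ := rfl }
  have hrange : LinearMap.range E ≤ LinearMap.range f.hom.toLinearMap := by
    rintro _ ⟨F, rfl⟩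
    let P : CommAlgCat.{u} k := CommAlgCat.of k (S ⊗[B] S)
    let i : S ⟶ P := CommAlgCat.ofHom Algebra.TensorProduct.includeLeft
    let j : S ⟶ P := CommAlgCat.ofHom (Algebra.TensorProduct.includeRight.restrictScalars k)
    -- The two pullbacks of g to S ⊗_B S lie over the same point of Spec B, so F(g) satisfies the
    -- descent condition.
    have key := hq.map_eq F g g i j (by
      rw [hg]
      ext b
      exact Algebra.TensorProduct.tmul_one_eq_one_tmul b)
    obtain ⟨b, hb⟩ := (Algebra.IsEffective.of_faithfullyFlat B S (F.1 S g)).1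
      (sub_eq_zero.2 key)
    exact ⟨b, hb⟩
  have : Module.Finite k (LinearMap.range E) :=
    Module.Finite.of_injective _ (Submodule.inclusion_injective hrange)
  refine Module.Finite.of_injective E.rangeRestrict ?_
  rw [← LinearMap.ker_eq_bot, LinearMap.ker_rangeRestrict, LinearMap.ker_eq_bot']
  intro F hF
  ext R x
  let _ : Algebra B R := (q R x).hom.toRingHom.toAlgebra
  have : IsScalarTower k B R :=
    IsScalarTower.of_algebraMap_eq fun y => ((q R x).hom.commutes y).symm
  let P : CommAlgCat.{u} k := CommAlgCat.of k (R ⊗[B] S)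
  let i : R ⟶ P := CommAlgCat.ofHom Algebra.TensorProduct.includeLeft
  let j : S ⟶ P := CommAlgCat.ofHom (Algebra.TensorProduct.includeRight.restrictScalars k)
  -- Over R ⊗_B S the points x and g lie in the same coset, so F(x) becomes F(g) = 0 there; R embeds
  -- in R ⊗_B S by faithful flatness.
  have key := hq.map_eq F x g i j (by
    rw [hg]
    ext b
    exact Algebra.TensorProduct.tmul_one_eq_one_tmul b)
  rw [show F.1 S g = 0 from hF, map_zero] at key
  have hinj : Function.Injective (algebraMap R (R ⊗[B] S)) :=
    FaithfulSMul.algebraMap_injective _ _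
  exact hinj (key.trans (map_zero _).symm)

end GroupFunctorFunctions

lemma mem_range_of_tmul_one_eq {F E : Type*} [Field F] [Field E] [Algebra F E] {x : E}
    (h : x ⊗ₜ[F] (1 : E) = 1 ⊗ₜ x) : x ∈ Set.range (algebraMap F E) :=
  (Algebra.IsEffective.of_faithfullyFlat F E x).1 (sub_eq_zero.2 h)

lemma character_inv_mul_eq_one_iff {k K Ω : Type u} [Field k] [Field K] [Field Ω] [Algebra k Ω]
    [Algebra K Ω] (u : Ωˣ) (R : CommAlgCat.{u} k) (g h : (tannakaGroup k K Ω).obj R) :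
    character k K u R (g⁻¹ * h) = 1 ↔ character k K u R g = character k K u R h := by
  constructor
  · intro H
    rw [← mul_inv_cancel_left g h, character_mul, H, mul_one]
  · intro H
    rw [character_mul, ← H, ← character_mul, inv_mul_cancel, character_one]

/-! ### The universal point over Ω ⊗_K Ω -/

section UniversalPoint

variable (k K Ω : Type u) [Field k] [Field K] [Field Ω] [Algebra k Ω] [Algebra K Ω]
  [Algebra k K] [IsScalarTower k K Ω]

/-- The left inclusion `Ω → Ω ⊗_K Ω` as a map of `k`-algebras. -/
def inclLeft : Ω →ₐ[k] Ω ⊗[K] Ω := Algebra.TensorProduct.includeLeft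

/-- The right inclusion `Ω → Ω ⊗_K Ω` as a map of `k`-algebras. -/
def inclRight : Ω →ₐ[k] Ω ⊗[K] Ω := Algebra.TensorProduct.includeRight.restrictScalars k

lemma inclLeft_algebraMap (a : K) :
    algebraMap K (Ω ⊗[K] Ω) a = inclLeft k K Ω (algebraMap K Ω a) := rfl

lemma inclRight_algebraMap (a : K) :
    algebraMap K (Ω ⊗[K] Ω) a = inclRight k K Ω (algebraMap K Ω a) :=
  Algebra.TensorProduct.tmul_one_eq_one_tmul a

/-- The tensor automorphism over `Ω ⊗_K Ω` given by the two inclusions of `Ω`. -/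
def universalPoint : tensorAut k K Ω (Ω ⊗[K] Ω) :=
  point (inclLeft k K Ω) (inclRight k K Ω) (inclLeft_algebraMap k K Ω)
    (inclRight_algebraMap k K Ω)

variable {k K Ω}

lemma universalPoint_apply (X : Triple k K Ω) (v : X.V) :
    ((universalPoint k K Ω).1 X).1 (extend X.W (inclLeft k K Ω) (X.ψ (1 ⊗ₜ v))) =
      extend X.W (inclRight k K Ω) (X.ψ (1 ⊗ₜ v)) :=
  point_apply _ _ _ _ X v

lemma character_universalPoint (u : Ωˣ) :
    character k K u (CommAlgCat.of k (Ω ⊗[K] Ω)) (universalPoint k K Ω) =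
      ((u⁻¹ : Ωˣ) : Ω) ⊗ₜ[K] (u : Ω) := by
  have h : ((u : Ω) ⊗ₜ[K] (1 : Ω)) *
      character k K u (CommAlgCat.of k (Ω ⊗[K] Ω)) (universalPoint k K Ω) =
      (1 : Ω) ⊗ₜ[K] (u : Ω) :=
    character_point (inclLeft k K Ω) (inclRight k K Ω) _ _ u
  have h' : (((u⁻¹ : Ωˣ) : Ω) ⊗ₜ[K] (1 : Ω)) * ((u : Ω) ⊗ₜ[K] (1 : Ω)) = 1 := by
    simp [Algebra.TensorProduct.one_def]
  have := congrArg (fun z => (((u⁻¹ : Ωˣ) : Ω) ⊗ₜ[K] (1 : Ω)) * z) h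
  rw [← mul_assoc, h', one_mul] at this
  refine this.trans ?_
  simp

/-- Characters of rank one triples agree only if the triples are isomorphic. -/
lemma div_mem_range_of_character_eq {u v : Ωˣ} (h : character k K u = character k K v) :
    (u : Ω) / v ∈ Set.range (algebraMap K Ω) := by
  have h1 := congrFun (congrFun h (CommAlgCat.of k (Ω ⊗[K] Ω))) (universalPoint k K Ω)
  rw [character_universalPoint, character_universalPoint] at h1
  apply mem_range_of_tmul_one_eq
  -- Multiplying u⁻¹ ⊗ u = v⁻¹ ⊗ v by u ⊗ v⁻¹ turns it into 1 ⊗ u/v = u/v ⊗ 1, the descent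
  -- condition.
  have h2 : ((u⁻¹ : Ωˣ) : Ω) ⊗ₜ[K] (u : Ω) * ((u : Ω) ⊗ₜ[K] (v : Ω)⁻¹) =
    ((v⁻¹ : Ωˣ) : Ω) ⊗ₜ[K] (v : Ω) * ((u : Ω) ⊗ₜ[K] (v : Ω)⁻¹) := by rw [h1]
  simp only [Algebra.TensorProduct.tmul_mul_tmul,
    mul_inv_cancel₀ v.ne_zero, Units.val_inv_eq_inv_val] at h2
  rw [inv_mul_cancel₀ u.ne_zero, mul_comm, ← div_eq_inv_mul] at h2
  exact h2.symm

end UniversalPoint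

/-! ### Separating the kernels of the characters of α and 1 + α -/

section Separation

variable {k K Ω : Type u} [Field k] [Field K] [Field Ω] [Algebra k Ω] [Algebra K Ω]
  [Algebra k K] [IsScalarTower k K Ω]

/-- The map `y ⊗ z ↦ y αⁱ r(α⁻ⁱ z)`; for `r` the constant coefficient it takes the coefficient
at `xⁱ` where `x = α⁻¹ ⊗ α`. -/
def twistedCoeff (r : Ω →ₗ[K] K) (α : Ω) (i : ℕ) : Ω ⊗[K] Ω →ₗ[K] Ω :=
  LinearMap.mul' K Ω ∘ₗ TensorProduct.map LinearMap.id
    (LinearMap.mulLeft K (α ^ i) ∘ₗ Algebra.linearMap K Ω ∘ₗ r ∘ₗ LinearMap.mulLeft K (α⁻¹ ^ i))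

lemma twistedCoeff_tmul (r : Ω →ₗ[K] K) (α : Ω) (i : ℕ) (y z : Ω) :
    twistedCoeff r α i (y ⊗ₜ z) = y * (α ^ i * algebraMap K Ω (r (α⁻¹ ^ i * z))) := by
  simp [twistedCoeff]

/-- Multiplication by x = α⁻¹ ⊗ α shifts coefficients by one degree. -/
lemma twistedCoeff_succ (r : Ω →ₗ[K] K) {α : Ω} (hα : α ≠ 0) (i : ℕ) (t : Ω ⊗[K] Ω) :
    twistedCoeff r α (i + 1) (t * (α⁻¹ ⊗ₜ α)) = twistedCoeff r α i t := by
  induction t with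
  | zero => simp
  | add a b ha hb => simp only [add_mul, map_add, ha, hb]
  | tmul y z =>
    rw [Algebra.TensorProduct.tmul_mul_tmul, twistedCoeff_tmul, twistedCoeff_tmul,
      show α⁻¹ ^ (i + 1) * (z * α) = α⁻¹ ^ i * z by
        rw [pow_succ, mul_comm z, mul_assoc, inv_mul_cancel_left₀ hα], pow_succ']
    rw [mul_assoc, mul_assoc α, inv_mul_cancel_left₀ hα]

/-- As αⁿ lies in K it passes through the K-linear form r and cancels, reflecting xⁿ = 1: the index
matters only modulo n. -/
lemma twistedCoeff_period (r : Ω →ₗ[K] K) {α : Ω} (hα : α ≠ 0) {n : ℕ} {c : K}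
    (hc : algebraMap K Ω c = α ^ n) :
    twistedCoeff r α n = twistedCoeff r α 0 := by
  have hc0 : c ≠ 0 := by
    rintro rfl
    exact pow_ne_zero n hα (by rw [← hc, map_zero])
  refine TensorProduct.ext' fun y z => ?_
  rw [twistedCoeff_tmul, twistedCoeff_tmul, inv_pow, ← hc, ← map_inv₀,
    ← Algebra.smul_def c⁻¹, map_smul, ← map_mul, smul_eq_mul, mul_inv_cancel_left₀ hc0]
  simp

/-- If `α` has degree `p` over `K` and `αᵖ ∈ K`, the kernel of the character of `α` is not
contained in the kernel of the character of `1 + α`. -/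
theorem exists_character_eq_one_and_ne_one {p : ℕ} (hp : 1 < p) (u v : Ωˣ) (huv : (v : Ω) = 1 + u)
    {c : K} (hc : algebraMap K Ω c = (u : Ω) ^ p) (hu : (u : Ω) ∉ Set.range (algebraMap k Ω))
    (r : Ω →ₗ[K] K) (r_one : r 1 = 1) (r_pow : ∀ j, 0 < j → j < p → r ((u : Ω) ^ j) = 0) :
    ∃ (R : CommAlgCat.{u} k) (g : (tannakaGroup k K Ω).obj R),
      character k K u R g = 1 ∧ character k K v R g ≠ 1 := by
  let T := Ω ⊗[K] Ω
  let x : T := (u : Ω)⁻¹ ⊗ₜ[K] (u : Ω)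
  let t : T := (v : Ω)⁻¹ ⊗ₜ[K] (v : Ω)
  let I : Ideal (T ⊗[k] T) := Ideal.span {x ⊗ₜ[k] 1 - 1 ⊗ₜ[k] x}
  let C (i : ℕ) : T →ₗ[k] Ω := (twistedCoeff r (u : Ω) i).restrictScalars k
  -- β is the convolution of coefficients in total degree 0 modulo p. Moving x from one factor to
  -- the other does not change it, so it descends to the quotient by I.
  let β : T ⊗[k] T →ₗ[k] Ω ⊗[k] Ω := ∑ i ∈ Finset.range p, TensorProduct.map (C i) (C (p - i))
  have hCp : C p = C 0 := by
    simp only [C, twistedCoeff_period r u.ne_zero hc]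
  have hCx : ∀ i s, C (i + 1) (s * x) = C i s := fun i s => twistedCoeff_succ r u.ne_zero i s
  have hβI : ∀ s ∈ I, β s = 0 := by
    intro s hs
    obtain ⟨s, rfl⟩ := Ideal.mem_span_singleton'.1 hs
    clear hs
    induction s with
    | zero => simp
    | add a b ha hb => simp only [add_mul, map_add, ha, hb, add_zero]
    | tmul a b =>
      rw [mul_sub, Algebra.TensorProduct.tmul_mul_tmul, Algebra.TensorProduct.tmul_mul_tmul,
        mul_one, mul_one, map_sub, sub_eq_zero]
      simp only [β, LinearMap.sum_apply, TensorProduct.map_tmul]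
      obtain ⟨m, rfl⟩ : ∃ m, p = m + 1 := ⟨p - 1, by omega⟩
      -- Cyclic reindexing: the first term of one sum is matched with the last term of the other
      -- through C p = C 0.
      rw [Finset.sum_range_succ', Finset.sum_range_succ, ← hCp, Nat.sub_zero, hCx, hCp,
        Nat.add_sub_cancel_left]
      congr 1
      · refine Finset.sum_congr rfl fun i hi => ?_
        have : i < m := Finset.mem_range.1 hi
        rw [hCx, Nat.add_sub_add_right, show m + 1 - i = (m - i) + 1 by omega, hCx]
      · rw [show (1 : ℕ) = 0 + 1 from rfl, hCx]
  have C_one : ∀ i, 0 < i → i < p → C i 1 = 0 := by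
    intro i hi hip
    change twistedCoeff r (u : Ω) i (1 ⊗ₜ 1) = 0
    -- With u^p = c, the power u⁻ⁱ is c⁻¹ u^(p-i), whose exponent lies strictly between 0 and p,
    -- where r vanishes.
    have : (u : Ω)⁻¹ ^ i * 1 = (c⁻¹ : K) • (u : Ω) ^ (p - i) := by
      rw [Algebra.smul_def, map_inv₀, hc, mul_one, inv_pow, eq_comm, inv_mul_eq_iff_eq_mul₀
        (pow_ne_zero _ u.ne_zero), ← div_eq_mul_inv, eq_div_iff (pow_ne_zero _ u.ne_zero), ← pow_add,
        Nat.sub_add_cancel hip.le]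
    rw [twistedCoeff_tmul, this, map_smul, r_pow _ (by omega) (by omega)]
    simp
  have C_zero_one : C 0 1 = 1 := by
    change twistedCoeff r (u : Ω) 0 (1 ⊗ₜ 1) = 1
    simp [twistedCoeff_tmul, r_one]
  have C_zero_t : C 0 t = (v : Ω)⁻¹ := by
    change twistedCoeff r (u : Ω) 0 (_ ⊗ₜ _) = _
    have := r_pow 1 one_pos hp
    rw [pow_one] at this
    rw [twistedCoeff_tmul, huv, pow_zero, pow_zero, one_mul, one_mul, map_add, r_one, this]
    simp
  have hβt : β (t ⊗ₜ 1) = (v : Ω)⁻¹ ⊗ₜ 1 := by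
    simp only [β, LinearMap.sum_apply, TensorProduct.map_tmul]
    rw [Finset.sum_eq_single 0]
    · rw [Nat.sub_zero, hCp, C_zero_one, C_zero_t]
    · intro i hi hi0
      rw [C_one (p - i) (by have := Finset.mem_range.1 hi; omega) (by omega),
        TensorProduct.tmul_zero]
    · simp; omega
  have hβt' : β (1 ⊗ₜ t) = 1 ⊗ₜ (v : Ω)⁻¹ := by
    simp only [β, LinearMap.sum_apply, TensorProduct.map_tmul]
    rw [Finset.sum_eq_single 0]
    · rw [Nat.sub_zero, hCp, C_zero_one, C_zero_t]
    · intro i hi hi0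
      rw [C_one i (by omega) (Finset.mem_range.1 hi), TensorProduct.zero_tmul]
    · simp; omega
  -- Over R the two copies of the universal point have the same value of χ_u, so g₁⁻¹g₂ lies in its
  -- kernel.
  let R : CommAlgCat.{u} k := CommAlgCat.of k ((T ⊗[k] T) ⧸ I)
  let i₁ : CommAlgCat.of k T ⟶ R :=
    CommAlgCat.ofHom ((Ideal.Quotient.mkₐ k I).comp Algebra.TensorProduct.includeLeft)
  let i₂ : CommAlgCat.of k T ⟶ R :=
    CommAlgCat.ofHom ((Ideal.Quotient.mkₐ k I).comp Algebra.TensorProduct.includeRight)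
  let g₁ := (tannakaGroup k K Ω).map i₁ (universalPoint k K Ω)
  let g₂ := (tannakaGroup k K Ω).map i₂ (universalPoint k K Ω)
  have hχ₁ : ∀ w : Ωˣ, character k K w R g₁ =
      Ideal.Quotient.mk I (((w : Ω)⁻¹ ⊗ₜ[K] (w : Ω)) ⊗ₜ[k] 1) := fun w => by
    refine (character_map w (CommAlgCat.of k T) R i₁ (universalPoint k K Ω)).trans ?_
    rw [character_universalPoint, Units.val_inv_eq_inv_val]
    rfl
  have hχ₂ : ∀ w : Ωˣ, character k K w R g₂ =
      Ideal.Quotient.mk I (1 ⊗ₜ[k] ((w : Ω)⁻¹ ⊗ₜ[K] (w : Ω))) := fun w => by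
    refine (character_map w (CommAlgCat.of k T) R i₂ (universalPoint k K Ω)).trans ?_
    rw [character_universalPoint, Units.val_inv_eq_inv_val]
    rfl
  refine ⟨R, g₁⁻¹ * g₂, ?_, fun h => ?_⟩
  · rw [character_inv_mul_eq_one_iff, hχ₁, hχ₂, Ideal.Quotient.eq]
    exact Ideal.subset_span rfl
  · have h1 := (character_inv_mul_eq_one_iff _ _ _ _).1 h
    rw [hχ₁, hχ₂, Ideal.Quotient.eq] at h1
    have h2 := hβI _ h1
    -- If χ_v also agreed, β would give v⁻¹ ⊗ 1 = 1 ⊗ v⁻¹ over k, so v⁻¹, and hence u = v - 1, would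
    -- lie in k.
    rw [map_sub, hβt, hβt', sub_eq_zero] at h2
    obtain ⟨a, ha⟩ := mem_range_of_tmul_one_eq h2
    refine hu ⟨a⁻¹ - 1, ?_⟩
    rw [map_sub, map_inv₀, ha, inv_inv, huv, map_one, add_sub_cancel_left]

end Separation

/-- The kernel of a character, as a closed subgroup. -/
def characterKer (k K : Type u) {Ω : Type u} [Field k] [Field K] [Field Ω] [Algebra k Ω]
    [Algebra K Ω] (u : Ωˣ) : ClosedSubgroup (tannakaGroup k K Ω) where
  carrier R :=
    { carrier := {g | character k K u R g = 1}
      one_mem' := character_one u R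
      mul_mem' := fun {g h} hg hh => by
        change character k K u R (g * h) = 1
        rw [character_mul, show character k K u R g = 1 from hg,
          show character k K u R h = 1 from hh, mul_one]
      inv_mem' := fun {g} hg => by
        change character k K u R g⁻¹ = 1
        rw [← mul_one g⁻¹, character_inv_mul_eq_one_iff, character_one]
        exact hg }
  map_mem f g hg := by
    change character k K u _ _ = 1
    rw [character_map, show character k K u _ g = 1 from hg, map_one]
  closed R g := by
    refine ⟨Ideal.span {character k K u R g - 1}, fun S f => ?_⟩
    change character k K u _ _ = 1 ↔ _
    rw [character_map]
    constructor
    · intro h a ha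
      obtain ⟨b, rfl⟩ := Ideal.mem_span_singleton'.1 ha
      rw [map_mul, map_sub, h, map_one, sub_self, mul_zero]
    · intro h
      have := h _ (Ideal.subset_span rfl)
      rwa [map_sub, map_one, sub_eq_zero] at this

/-! ### Which characters are trivial on π(L) -/

section Pullback

variable {k K Ω : Type u} [Field k] [Field K] [Field Ω] [Algebra k Ω] [Algebra K Ω]
  {L Ω' : Type u} [Field L] [Field Ω'] [Algebra k Ω'] [Algebra L Ω'] [Algebra K L]
  [Algebra K Ω'] [IsScalarTower K L Ω'] [Algebra Ω Ω'] [IsScalarTower K Ω Ω']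
  [IsScalarTower k Ω Ω']

variable (L Ω') in
lemma Triple.pullback_line_ψ (u : Ωˣ) :
    ((Triple.line k K u).pullback L Ω').ψ ((1 : Ω') ⊗ₜ[L] ((1 : L) ⊗ₜ[K] (1 : K))) =
      (algebraMap Ω Ω' u) ⊗ₜ[k] (1 : k) := by
  refine (Triple.pullback_ψ L Ω' (Triple.line k K u) (1 : K)).trans ?_
  refine (congrArg _ (Triple.line_ψ u)).trans ?_
  rfl

/-- The pullback of the rank one triple of `u` maps to the unit triple if `u` comes from `L`. -/
def Triple.pullbackLineToUnit (u : Ωˣ) (l : L) (hl : algebraMap L Ω' l = algebraMap Ω Ω' u) :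
    (Triple.line k K u).pullback L Ω' ⟶ Triple.unit k L Ω' where
  -- Multiplication by l on the L-side absorbs the factor u in ψ, so the identity on W is compatible
  -- with it.
  a := l • (AlgebraTensorModule.rid K L L).toLinearMap
  b := LinearMap.id
  comm := Triple.pullback_ext (V := K) L Ω'
    ((Triple.unit k L Ω').ψ.toLinearMap ∘ₗ
      (l • (AlgebraTensorModule.rid K L L).toLinearMap).baseChange Ω')
    (LinearMap.id.baseChange Ω' ∘ₗ ((Triple.line k K u).pullback L Ω').ψ.toLinearMap) fun v => by
      obtain ⟨v, rfl⟩ : ∃ w : K, w • (1 : K) = v := ⟨v, by simp⟩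
      have h1 : ((1 : Ω') ⊗ₜ[L] ((1 : L) ⊗ₜ[K] (v • (1 : K)))) =
          (algebraMap K Ω' v) • ((1 : Ω') ⊗ₜ[L] ((1 : L) ⊗ₜ[K] (1 : K))) := by
        rw [TensorProduct.tmul_smul, TensorProduct.tmul_smul, algebraMap_smul]
      rw [h1, map_smul, map_smul]
      congr 1
      rw [LinearMap.comp_apply, LinearMap.comp_apply, LinearEquiv.coe_coe, LinearEquiv.coe_coe]
      have h2 := Triple.pullback_line_ψ (k := k) (K := K) L Ω' u
      rw [h2, ← hl, LinearMap.baseChange_id, LinearMap.id_apply]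
      have h3 : AlgebraTensorModule.rid L Ω' Ω' (l • (1 : Ω') ⊗ₜ[L] (1 : L)) =
          algebraMap L Ω' l := by
        rw [TensorProduct.smul_tmul', AlgebraTensorModule.rid_tmul, one_smul,
          Algebra.algebraMap_eq_smul_one]
      simpa using congrArg (· ⊗ₜ[k] (1 : k)) h3

/-- The image of `π(L)` lies in the kernel of the characters that come from elements of `L`. -/
lemma character_tannakaMap_eq_one (u : Ωˣ) (l : L) (hl : algebraMap L Ω' l = algebraMap Ω Ω' u)
    (R : CommAlgCat.{u} k) (g : (tannakaGroup k L Ω').obj R) :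
    character k K u R ((tannakaMap (k := k) (K := K) (Ω := Ω) L Ω').app R g) = 1 := by
  -- The morphism to the unit triple is the identity on W, so g acts on the pulled back line as on
  -- the unit, that is, trivially.
  have h1 := g.2.1 _ _ (Triple.pullbackLineToUnit (k := k) (K := K) u l hl) ((1 : R) ⊗ₜ[k] (1 : k))
  rw [g.2.2.2] at h1
  have h2 : (g.1 ((Triple.line k K u).pullback L Ω')).1 ((1 : R) ⊗ₜ[k] (1 : k)) =
      (1 : R) ⊗ₜ[k] (1 : k) := by
    simpa [Triple.pullbackLineToUnit] using h1.symm
  have := endScalar_eq (k := k) (R := R) h2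
  rw [one_mul] at this
  exact this

/-- A character that is trivial on the image of `π(L)` comes from an element of `L`. -/
lemma mem_range_of_character_tannakaMap [Algebra k L] [IsScalarTower k L Ω'] (u : Ωˣ)
    (h : character k K u (CommAlgCat.of k (Ω' ⊗[L] Ω'))
      ((tannakaMap (k := k) (K := K) (Ω := Ω) L Ω').app _ (universalPoint k L Ω')) = 1) :
    algebraMap Ω Ω' u ∈ Set.range (algebraMap L Ω') := by
  apply mem_range_of_tmul_one_eq
  have h1 := universalPoint_apply ((Triple.line k K u).pullback L Ω') ((1 : L) ⊗ₜ[K] (1 : K))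
  rw [Triple.pullback_line_ψ] at h1
  have h2 := endScalar_eq (k := k) (R := Ω' ⊗[L] Ω') h1
  have h3 : inclLeft k L Ω' (algebraMap Ω Ω' u) * 1 = inclRight k L Ω' (algebraMap Ω Ω' u) :=
    (congrArg (inclLeft k L Ω' (algebraMap Ω Ω' u) * ·) h.symm).trans h2
  rw [mul_one] at h3
  exact h3

end Pullback

/-- A linear form picking out the constant coefficient of polynomials in a `p`-th root. -/
lemma exists_constantCoeff {K Ω : Type*} [Field K] [Field Ω] [Algebra K Ω] {p : ℕ} (hp : p.Prime)
    {c : K} (hc : ∀ d : K, d ^ p ≠ c) {α : Ω} (hα : algebraMap K Ω c = α ^ p) :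
    ∃ r : Ω →ₗ[K] K, r 1 = 1 ∧ ∀ j, 0 < j → j < p → r (α ^ j) = 0 := by
  have hirr := X_pow_sub_C_irreducible_of_prime hp hc
  have hmin : Polynomial.X ^ p - Polynomial.C c = minpoly K α :=
    minpoly.eq_of_irreducible_of_monic hirr (by simp [hα])
      (Polynomial.monic_X_pow_sub_C c hp.ne_zero)
  have hdeg : (minpoly K α).natDegree = p := by
    rw [← hmin, Polynomial.natDegree_X_pow_sub_C]
  have hli := linearIndependent_pow (K := K) α
  rw [hdeg] at hli
  -- The powers of α below p are a basis of their span; the coordinate at 1 extends to a form on all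
  -- of Ω.
  obtain ⟨r, hr⟩ := LinearMap.exists_extend ((Module.Basis.span hli).coord ⟨0, hp.pos⟩)
  have key : ∀ j (hj : j < p), r (α ^ j) = if j = 0 then 1 else 0 := by
    intro j hj
    have h1 := LinearMap.congr_fun hr (Module.Basis.span hli ⟨j, hj⟩)
    rw [LinearMap.comp_apply, Module.Basis.coord_apply, Module.Basis.repr_self,
      Finsupp.single_apply, Submodule.subtype_apply, Module.Basis.span_apply] at h1
    simpa using h1
  exact ⟨r, by simpa using key 0 hp.pos, fun j hj hjp => by rw [key j hjp, if_neg hj.ne']⟩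

lemma exists_forall_pow_ne {p : ℕ} [Fact p.Prime] {K : Type*} [Field K] [CharP K p]
    (hK : ¬ PerfectField K) : ∃ c : K, ∀ d : K, d ^ p ≠ c := by
  by_contra! h
  have : PerfectRing K p := PerfectRing.ofSurjective K p fun c => h c
  exact hK (PerfectRing.toPerfectField K p)

/-- Frobenius is injective, hence surjective on a finite field. -/
lemma infinite_of_forall_pow_ne {p : ℕ} [Fact p.Prime] {K : Type*} [Field K] [CharP K p]
    {c : K} (hc : ∀ d : K, d ^ p ≠ c) : Infinite K := by
  by_contra h
  have : Finite K := not_infinite_iff_finite.1 h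
  obtain ⟨d, hd⟩ := (Finite.injective_iff_surjective.1 (frobenius_inj K p)) c
  exact hc d hd

/-- The elements `1 + a α` are pairwise non-proportional over `K` for `α ∉ K`. -/
lemma eq_of_one_add_mul_eq {K E : Type*} [Field K] [CommRing E] [Nontrivial E] [Algebra K E]
    {α : E} (hα : α ∉ Set.range (algebraMap K E)) {a b e : K}
    (h : 1 + algebraMap K E a * α = algebraMap K E e * (1 + algebraMap K E b * α)) : a = b := by
  have h1 : algebraMap K E (a - e * b) * α = algebraMap K E (e - 1) := by
    simp only [map_sub, map_mul, map_one]
    linear_combination h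
  have h2 : a - e * b = 0 := by
    by_contra hne
    refine hα ⟨(a - e * b)⁻¹ * (e - 1), ?_⟩
    rw [map_mul, ← h1, ← mul_assoc, ← map_mul, inv_mul_cancel₀ hne, map_one, one_mul]
  rw [h2, map_zero, zero_mul, eq_comm, map_eq_zero_iff _ (algebraMap K E).injective,
    sub_eq_zero] at h1
  rw [h1, one_mul, sub_eq_zero] at h2
  exact h2

/-! ### The first two claims for K^perf -/

section PerfectClosure

variable {p : ℕ} [Fact p.Prime] {k K L : Type u} [Field k] [Field K] [CharP K p] [Field L]
  [CharP L p] [Algebra k K] [Algebra k L] [Algebra K L] [IsScalarTower k K L]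

instance (k K : Type u) [Field k] [Field K] [CharP K p] [Algebra k K] :
    IsScalarTower k K (PerfectClosure K p) := IsScalarTower.of_algebraMap_eq fun _ => rfl

lemma perfectClosure_algebraMap_self (x : K) :
    algebraMap K (PerfectClosure K p) x = PerfectClosure.of K p x := rfl

lemma character_localNoriGroupMap_eq_one (u : (PerfectClosure K p)ˣ) (l : L)
    (hl : PerfectClosure.of L p l = perfectClosureMap p K L u) (R : CommAlgCat.{u} k)
    (g : (localNoriGroup p k L).obj R) :
    character k K u R ((localNoriGroupMap p k K L).app R g) = 1 := by
  let _ : Algebra (PerfectClosure K p) (PerfectClosure L p) := (perfectClosureMap p K L).toAlgebra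
  have : IsScalarTower K L (PerfectClosure L p) := IsScalarTower.of_algebraMap_eq fun _ => rfl
  have : IsScalarTower K (PerfectClosure K p) (PerfectClosure L p) :=
    IsScalarTower.of_algebraMap_eq fun x => (perfectClosureMap_of p K L x).symm
  have : IsScalarTower k (PerfectClosure K p) (PerfectClosure L p) :=
    IsScalarTower.of_algebraMap_eq fun x => by
      rw [perfectClosure_algebraMap, IsScalarTower.algebraMap_apply k K L]
      exact (perfectClosureMap_of p K L _).symm
  exact character_tannakaMap_eq_one (k := k) (K := K) u l hl R g

lemma mem_range_of_character_localNoriGroupMap (u : (PerfectClosure K p)ˣ)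
    (h : ∀ (R : CommAlgCat.{u} k) (g : (localNoriGroup p k L).obj R),
      character k K u R ((localNoriGroupMap p k K L).app R g) = 1) :
    perfectClosureMap p K L u ∈ Set.range (PerfectClosure.of L p) := by
  let _ : Algebra (PerfectClosure K p) (PerfectClosure L p) := (perfectClosureMap p K L).toAlgebra
  have : IsScalarTower K L (PerfectClosure L p) := IsScalarTower.of_algebraMap_eq fun _ => rfl
  have : IsScalarTower K (PerfectClosure K p) (PerfectClosure L p) :=
    IsScalarTower.of_algebraMap_eq fun x => (perfectClosureMap_of p K L x).symm
  have : IsScalarTower k (PerfectClosure K p) (PerfectClosure L p) :=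
    IsScalarTower.of_algebraMap_eq fun x => by
      rw [perfectClosure_algebraMap, IsScalarTower.algebraMap_apply k K L]
      exact (perfectClosureMap_of p K L _).symm
  exact mem_range_of_character_tannakaMap (k := k) (K := K) u (h _ _)

/-- Every element of a purely inseparable extension `L` of `K` comes from `K^perf`. -/
lemma exists_perfectClosureMap_eq [IsPurelyInseparable K L] (l : L) :
    ∃ x : PerfectClosure K p, perfectClosureMap p K L x = PerfectClosure.of L p l := by
  obtain ⟨n, a, ha⟩ := IsPurelyInseparable.pow_mem K p l
  obtain ⟨x, hx⟩ := (bijective_iterateFrobenius (PerfectClosure K p) p n).2 (PerfectClosure.of K p a)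
  -- Frobenius is injective on L^perf, so it suffices to compare pⁿ-th powers, which both come from
  -- a ∈ K.
  refine ⟨x, iterateFrobenius_inj (PerfectClosure L p) p n ?_⟩
  rw [iterateFrobenius_def, iterateFrobenius_def, ← map_pow, ← map_pow, ← iterateFrobenius_def, hx,
    perfectClosureMap_of, ha]

variable (k) in
/-- For `K` imperfect, the kernel of the character of a `p`-th root is not the image of a
`π(L)`. -/
theorem exists_closedSubgroup_ne_image (hK : ¬ PerfectField K) :
    ∃ H : ClosedSubgroup (localNoriGroup p k K),
      ∀ (L : Type u) [Field L] [CharP L p] [Algebra k L] [Algebra K L] [IsScalarTower k K L],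
        H.carrier ≠ imageSubgroup (localNoriGroupMap p k K L) := by
  have hp : p.Prime := Fact.out
  obtain ⟨c, hc⟩ := exists_forall_pow_ne (p := p) hK
  obtain ⟨α, hα⟩ := (bijective_frobenius (PerfectClosure K p) p).2 (PerfectClosure.of K p c)
  rw [frobenius_def] at hα
  have hαK : α ∉ Set.range (algebraMap K (PerfectClosure K p)) := by
    rintro ⟨a, rfl⟩
    rw [← map_pow] at hα
    exact hc a ((algebraMap K (PerfectClosure K p)).injective hα)
  let u : (PerfectClosure K p)ˣ := Units.mk0 α fun h => hαK ⟨0, by rw [h, map_zero]⟩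
  let v : (PerfectClosure K p)ˣ := Units.mk0 (1 + α) fun h => hαK
    ⟨-1, by rw [map_neg, map_one]; exact (eq_neg_of_add_eq_zero_right h).symm⟩
  obtain ⟨r, hr1, hr⟩ := exists_constantCoeff (K := K) hp hc hα.symm
  obtain ⟨R, g, hg, hg'⟩ := exists_character_eq_one_and_ne_one (k := k) (K := K) hp.one_lt u v rfl
    (c := c) hα.symm
    (fun ⟨a, ha⟩ => hαK ⟨algebraMap k K a, (IsScalarTower.algebraMap_apply k K _ a).symm.trans ha⟩)
    r hr1 hr
  refine ⟨characterKer k K u, fun L _ _ _ _ _ hH => hg' ?_⟩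
  obtain ⟨l, hl⟩ := mem_range_of_character_localNoriGroupMap (k := k) (L := L) u fun S x => by
    have : (localNoriGroupMap p k K L).app S x ∈ (characterKer k K u).carrier S := by
      rw [hH]
      exact ⟨x, rfl⟩
    exact this
  have hmem : g ∈ (characterKer k K u).carrier R := hg
  rw [hH] at hmem
  obtain ⟨x, rfl⟩ := hmem
  -- As l ∈ L represents α, the element 1 + l ∈ L represents 1 + α, so its character is trivial on
  -- the image of π(L), contradicting the choice of g.
  refine character_localNoriGroupMap_eq_one v (1 + l) ?_ R x
  rw [map_add, map_one, hl]
  change _ = perfectClosureMap p K L (1 + α)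
  rw [map_add, map_one]
  rfl

/-- For a nontrivial purely inseparable extension `L/K`, the functions on `π(K)/π(L)` form an
infinite dimensional space. -/
theorem not_finite_quotientFunctions [IsPurelyInseparable K L]
    (hL : ¬ Function.Surjective (algebraMap K L)) (hK : ¬ PerfectField K) :
    ¬ Module.Finite k (quotientFunctions (localNoriGroup p k K)
      (imageSubgroup (localNoriGroupMap p k K L))) := by
  intro hfin
  obtain ⟨c, hc⟩ := exists_forall_pow_ne (p := p) hK
  have : Infinite K := infinite_of_forall_pow_ne hc
  obtain ⟨β, hβ⟩ := not_forall.1 hL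
  obtain ⟨α, hα⟩ := exists_perfectClosureMap_eq (p := p) (K := K) β
  have hαK : α ∉ Set.range (algebraMap K (PerfectClosure K p)) := by
    rintro ⟨a, rfl⟩
    rw [perfectClosure_algebraMap_self, perfectClosureMap_of] at hα
    exact hβ ⟨a, (PerfectClosure.of L p).injective hα⟩
  have hne : ∀ a : K, 1 + algebraMap K (PerfectClosure K p) a * α ≠ 0 := by
    intro a ha
    -- A vanishing 1 + aα would be 0 times any other such element; e = 0 and b = a + 1 give a = a +
    -- 1.
    have h0 := eq_of_one_add_mul_eq hαK (a := a) (b := a + 1) (e := 0) (by rw [ha]; simp)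
    simp at h0
  let u (a : K) : (PerfectClosure K p)ˣ := Units.mk0 _ (hne a)
  have hinj : Function.Injective fun a => character k K (u a) := by
    intro a b hab
    obtain ⟨e, he⟩ := div_mem_range_of_character_eq hab
    refine eq_of_one_add_mul_eq hαK (e := e) ?_
    rw [he]
    exact (div_mul_cancel₀ _ (u b).ne_zero).symm
  have hli : LinearIndependent k fun a => character k K (u a) :=
    linearIndependent_characters _ (fun a => character_map (u a))
      (fun a => character_mul (u a)) (fun a => character_one (u a)) hinj
  let F (a : K) : quotientFunctions (localNoriGroup p k K)
      (imageSubgroup (localNoriGroupMap p k K L)) :=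
    ⟨character k K (u a), character_map (u a), by
      rintro R g _ ⟨x, rfl⟩
      refine (character_mul (u a) R g _).trans ?_
      erw [character_localNoriGroupMap_eq_one (u a) (1 + algebraMap K L a * β) (by
        change _ = perfectClosureMap p K L (1 + algebraMap K (PerfectClosure K p) a * α)
        rw [perfectClosure_algebraMap_self]
        simp only [map_add, map_mul, map_one, hα, perfectClosureMap_of]) R x]
      exact mul_one _⟩
  have hF : LinearIndependent k F := LinearIndependent.of_comp (Subalgebra.val _).toLinearMap hli
  have := hF.finite_of_isNoetherian
  exact not_finite K

end PerfectClosure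

/-! ### The group L^*/K^* -/

open Polynomial in
/-- The unit quotient of a purely inseparable extension of degree `p`. -/
theorem infinite_and_not_fg_unitsQuotient {p : ℕ} [Fact p.Prime] {K : Type u} [Field K]
    [CharP K p] {c : K} (hc : ∀ d : K, d ^ p ≠ c) :
    Infinite (unitsQuotient K (AdjoinRoot (X ^ p - C c))) ∧
      ¬ Group.FG (unitsQuotient K (AdjoinRoot (X ^ p - C c))) := by
  have hp : p.Prime := Fact.out
  have hirr := X_pow_sub_C_irreducible_of_prime hp hc
  have : Fact (Irreducible (X ^ p - C c)) := ⟨hirr⟩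
  set E := AdjoinRoot (X ^ p - C c)
  have : CharP E p := charP_of_injective_algebraMap (algebraMap K E).injective p
  let α : E := AdjoinRoot.root _
  have hα : α ^ p = algebraMap K E c := by
    have := AdjoinRoot.eval₂_root (X ^ p - C c)
    rwa [eval₂_sub, eval₂_X_pow, eval₂_C, sub_eq_zero] at this
  have hαK : α ∉ Set.range (algebraMap K E) := by
    rintro ⟨a, ha⟩
    rw [← ha, ← map_pow] at hα
    exact hc a ((algebraMap K E).injective hα)
  have : Infinite K := infinite_of_forall_pow_ne hc
  have hne : ∀ a : K, 1 + algebraMap K E a * α ≠ 0 := by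
    intro a ha
    have h0 := eq_of_one_add_mul_eq hαK (a := a) (b := a + 1) (e := 0) (by rw [ha]; simp)
    simp at h0
  have hinf : Infinite (unitsQuotient K E) := by
    refine Infinite.of_injective (fun a : K => (QuotientGroup.mk (Units.mk0 _ (hne a)) :
      unitsQuotient K E)) fun a b hab => ?_
    obtain ⟨e, he⟩ := QuotientGroup.eq.1 hab.symm
    refine eq_of_one_add_mul_eq hαK (e := (e : K)) ?_
    have := congrArg Units.val ((eq_inv_mul_iff_mul_eq.1 he))
    exact this.symm.trans (mul_comm _ _)
  refine ⟨hinf, fun hfg => ?_⟩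
  -- In characteristic p the p-th power of Σ aₙαⁿ is Σ aₙ^p cⁿ, an element of K; hence the unit
  -- quotient is torsion.
  have hpow : ∀ x : E, ∃ a : K, algebraMap K E a = x ^ p := by
    intro x
    obtain ⟨f, rfl⟩ := AdjoinRoot.mk_surjective x
    induction f using Polynomial.induction_on' with
    | add f g hf hg =>
      obtain ⟨a, ha⟩ := hf
      obtain ⟨b, hb⟩ := hg
      exact ⟨a + b, by rw [map_add, map_add, add_pow_char, ha, hb]⟩
    | monomial n a =>
      refine ⟨a ^ p * c ^ n, ?_⟩
      rw [← C_mul_X_pow_eq_monomial, map_mul, map_pow, map_mul, map_pow, map_pow, ← hα, mul_pow,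
        ← pow_mul, ← pow_mul, mul_comm p n]
      rfl
  have htors : IsMulTorsion (unitsQuotient K E) := by
    intro x
    obtain ⟨y, rfl⟩ := QuotientGroup.mk_surjective x
    rw [isOfFinOrder_iff_pow_eq_one]
    refine ⟨p, hp.pos, ?_⟩
    rw [← QuotientGroup.mk_pow, QuotientGroup.eq_one_iff]
    obtain ⟨a, ha⟩ := hpow y
    have ha0 : a ≠ 0 := by
      rintro rfl
      rw [map_zero] at ha
      exact pow_ne_zero p y.ne_zero ha.symm
    exact ⟨Units.mk0 a ha0, Units.ext (ha.trans (Units.val_pow_eq_pow_val _ _).symm)⟩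
  have := CommGroup.finite_of_fg_isMulTorsion (unitsQuotient K E) htors
  exact not_finite (unitsQuotient K E)

end LocalNori

end

open LocalNori Polynomial in
theorem mainTheorem3 (p : ℕ) [Fact p.Prime] (k K : Type u) [Field k] [CharP k p] [PerfectField k]
    [Field K] [CharP K p] [Algebra k K] (hK : ¬ PerfectField K) :
    (∃ H : ClosedSubgroup (localNoriGroup p k K),
      ∀ (L : Type u) [Field L] [CharP L p] [Algebra k L] [Algebra K L] [IsScalarTower k K L]
        [IsPurelyInseparable K L],
        H.carrier ≠ imageSubgroup (localNoriGroupMap p k K L)) ∧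
    (∀ (L : Type u) [Field L] [CharP L p] [Algebra k L] [Algebra K L] [IsScalarTower k K L]
      [IsPurelyInseparable K L], ¬ Function.Surjective (algebraMap K L) →
        ¬ QuotientIsFinite (localNoriGroup p k K) (imageSubgroup (localNoriGroupMap p k K L)) ∧
        ¬ Module.Finite k (quotientFunctions (localNoriGroup p k K)
          (imageSubgroup (localNoriGroupMap p k K L)))) ∧
    (∀ c : K, (∀ d : K, d ^ p ≠ c) →
      Infinite (unitsQuotient K (AdjoinRoot (X ^ p - C c))) ∧
      ¬ Group.FG (unitsQuotient K (AdjoinRoot (X ^ p - C c)))) := by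
  refine ⟨?_, fun L _ _ _ _ _ _ hL => ?_, fun c hc => infinite_and_not_fg_unitsQuotient hc⟩
  · obtain ⟨H, hH⟩ := exists_closedSubgroup_ne_image (p := p) k hK
    exact ⟨H, fun L => hH L⟩
  · have h := not_finite_quotientFunctions (p := p) (k := k) hL hK
    -- Infinite dimensionality of the functions also rules out a finite quotient scheme.
    exact ⟨fun hfin => h (finite_quotientFunctions hfin), h⟩
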